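/- Consider a dual-hop amplify-and-forward system in which a single-antenna source communicates with a single-antenna destination through a relay with $N$ antennas, the relay being subject to $M$ co-channel interferers, with $N>M$. The channels are $\mathbf h_1\in\mathbb C^{N\times 1}$ (source–relay), $\mathbf h_2\in\mathbb C^{1\times N}$ (relay–destination) and $\mathbf H_I=[\mathbf h_{I1},\dots,\mathbf h_{IM}]\in\mathbb C^{N\times M}$ (interferers–relay), all of whose entries are independent $\mathcal{CN}(0,1)$ random variables. Let $P_s>0$ be the source power, $P_r>0$ the relay power, $P_{Ii}\ge 0$ the power of the $i$-th interferer and $N_0>0$ the noise power per antenna at the relay and at the destination, and put $\rho_1=P_s/N_0$, $\rho_2=P_r/N_0$. For a relay precoder $\mathbf W\in\mathbb C^{N\times N}$ the end-to-end SINR is $$\gamma(\mathbf W)=\frac{|\mathbf h_2\mathbf W\mathbf h_1|^2P_s}{\sum_{i=1}^M|\mathbf h_2\mathbf W\mathbf h_{Ii}|^2P_{Ii}+\|\mathbf h_2\mathbf W\|^2N_0+N_0},$$ and the power transmitted by the relay is $\|\mathbf W\mathbf h_1\|^2P_s+\sum_{i=1}^M\|\mathbf W\mathbf h_{Ii}\|^2P_{Ii}+\|\mathbf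 W\|_F^2N_0$. In the ZF/MRT scheme, $\mathbf W=\omega\,\frac{\mathbf h_2^\dagger}{\|\mathbf h_2\|}\mathbf w_1$, where the real factor $\omega$ is such that the power transmitted by the relay equals $P_r$, and the row vector $\mathbf w_1\in\mathbb C^{1\times N}$ maximizes the end-to-end SINR subject to $\mathbf w_1\mathbf H_I=\mathbf 0$ and $\|\mathbf w_1\|=1$. Then such a maximizing precoder exists almost surely, and for every $\gamma_{\mathsf{th}}>0$ and every choice of maximizing precoders the outage probability $P_{\mathsf{out}}^{\mathsf{ZF}}=\mathrm{Prob}(\gamma(\mathbf W)<\gamma_{\mathsf{th}})$ is $$P_{\mathsf{out}}^{\mathsf{ZF}}=1-\frac{2e^{-\frac{\gamma_{\mathsf{th}}}{\rho_1}-\frac{\gamma_{\mathsf{th}}}{\rho_2}}}{\Gamma(N)}\sum_{m=0}^{N-M-1}\Big(\frac{\gamma_{\mathsf{th}}}{\rho_1}\Big)^m\frac1{m!}\sum_{j=0}^m\binom mj\Big(\frac1{\rho_2}\Big)^{m-j}\sum_{k=0}^{N+j-1}\binom{N+j-1}{k}\Big(\frac{\gamma_{\mathsf{th}}}{\rho_2}\Big)^{N+j-k-1}\Big(\frac{(1+\gamma_{\mathsf{th}})\gamma_{\mathsf{th}}}{\rho_1\rho_2}\Big)^{\frac{k-m+1}2}K_{k-m+1}\!\left(2\sqrt{\frac{(1+\gamma_{\mathsf{th}})\gamma_{\mathsf{th}}}{\rho_1\rho_2}}\right),$$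 where $K_\nu$ is the modified Bessel function of the second kind of order $\nu$, i.e. $K_\nu(x)=\int_0^\infty e^{-x\cosh t}\cosh(\nu t)\,dt$ for $x>0$. -/

import Mathlib

open MeasureTheory ProbabilityTheory Matrix
open scoped NNReal

namespace AFRelay

noncomputable section

/-- The modified Bessel function of the second kind `K_ν(x)`, for real order `ν` and `x > 0`:
`K_ν(x) = ∫_0^∞ exp (-x cosh t) cosh (ν t) dt`. -/
def besselK (ν x : ℝ) : ℝ :=
  ∫ t in Set.Ioi (0 : ℝ), Real.exp (-x * Real.cosh t) * Real.cosh (ν * t)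

/-- The circularly symmetric complex Gaussian law `CN(0,1)`: real and imaginary parts are
independent real Gaussians of mean `0` and variance `1/2`. -/
def stdComplexGaussian : Measure ℂ :=
  ((gaussianReal 0 (1 / 2 : ℝ≥0)).prod (gaussianReal 0 (1 / 2 : ℝ≥0))).map
    (fun p : ℝ × ℝ => (⟨p.1, p.2⟩ : ℂ))

/-- The squared Euclidean norm of a complex vector. -/
def normSq {N : ℕ} (v : Fin N → ℂ) : ℝ := ∑ i, ‖v i‖ ^ 2

/-- The squared Frobenius norm of a complex matrix. -/
def frobSq {N : ℕ} (A : Matrix (Fin N) (Fin N) ℂ) : ℝ := ∑ i, ∑ j, ‖A i j‖ ^ 2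

/-- Rayleigh fading: all the entries of the source-relay channel `h₁`, of the relay-destination
channel `h₂` and of the interference channel matrix `H` (whose `i`-th column is the channel from
the `i`-th interferer to the relay) are jointly independent, each with law `CN(0,1)`. -/
structure IsRayleigh {N M : ℕ} {Ω : Type*} [MeasurableSpace Ω] (μ : Measure Ω)
    (h₁ h₂ : Ω → Fin N → ℂ) (H : Ω → Matrix (Fin N) (Fin M) ℂ) : Prop where
  law_h₁ : ∀ n, HasLaw (fun ω => h₁ ω n) stdComplexGaussian μ
  law_h₂ : ∀ n, HasLaw (fun ω => h₂ ω n) stdComplexGaussian μ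
  law_H : ∀ n i, HasLaw (fun ω => H ω n i) stdComplexGaussian μ
  indep : iIndepFun (β := fun _ : Fin N ⊕ Fin N ⊕ Fin N × Fin M => ℂ)
    (Sum.elim (fun n ω => h₁ ω n)
      (Sum.elim (fun n ω => h₂ ω n) (fun p ω => H ω p.1 p.2))) μ

/-- The transmit powers: source power `Ps`, relay power `Pr`, interferer powers `PI i`, and
the noise power `N0` at the relay (per antenna) and at the destination. -/
structure Powers (M : ℕ) where
  Ps : ℝ
  Pr : ℝ
  N0 : ℝ
  PI : Fin M → ℝ
  Ps_pos : 0 < Ps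
  Pr_pos : 0 < Pr
  N0_pos : 0 < N0
  PI_nonneg : ∀ i, 0 ≤ PI i

variable {N M : ℕ}

/-- The power `E ‖W y‖²` transmitted by a relay with precoder `W`, given the channels, where
`y = h₁ x + ∑ i, hᵢ sᵢ + n` is the received signal; the source symbol `x`, the interference
symbols `sᵢ` and the noise `n` are centred and uncorrelated, with `E |x|² = Ps`,
`E |sᵢ|² = PI i` and `E n n† = N0 • 1`. -/
def relayPower (p : Powers M) (h₁ : Fin N → ℂ) (H : Matrix (Fin N) (Fin M) ℂ)
    (W : Matrix (Fin N) (Fin N) ℂ) : ℝ :=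
  normSq (W *ᵥ h₁) * p.Ps + (∑ i, normSq (W *ᵥ H.col i) * p.PI i) + frobSq W * p.N0

/-- The end-to-end signal-to-interference-and-noise ratio for the precoder `W`. -/
def sinr (p : Powers M) (h₁ h₂ : Fin N → ℂ) (H : Matrix (Fin N) (Fin M) ℂ)
    (W : Matrix (Fin N) (Fin N) ℂ) : ℝ :=
  ‖h₂ ⬝ᵥ (W *ᵥ h₁)‖ ^ 2 * p.Ps /
    ((∑ i, ‖h₂ ⬝ᵥ (W *ᵥ H.col i)‖ ^ 2 * p.PI i) + normSq (h₂ ᵥ* W) * p.N0 + p.N0)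

/-- The precoder `a • (h₂† / ‖h₂‖) w`: linear combining with the row vector `w`, followed by
maximal ratio transmission matched to the row vector `h₂`, with amplification factor `a`. -/
def mrtPrecoder (h₂ : Fin N → ℂ) (a : ℝ) (w : Fin N → ℂ) : Matrix (Fin N) (Fin N) ℂ :=
  ((a / Real.sqrt (normSq h₂) : ℝ) : ℂ) • vecMulVec (star h₂) w

/-- Precoders admissible for the ZF/MRT scheme: of MRT form with a unit-norm combining vector
`w` that completely nulls the interference, `w H = 0`, and meeting the relay power constraint. -/
def IsZFAdmissible (p : Powers M) (h₁ h₂ : Fin N → ℂ) (H : Matrix (Fin N) (Fin M) ℂ)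
    (W : Matrix (Fin N) (Fin N) ℂ) : Prop :=
  (∃ (a : ℝ) (w : Fin N → ℂ), normSq w = 1 ∧ w ᵥ* H = 0 ∧ W = mrtPrecoder h₂ a w) ∧
    relayPower p h₁ H W = p.Pr

/-- `W` is a precoder of the ZF/MRT scheme: it maximizes the end-to-end SINR among the
admissible ones. -/
def IsZFMRT (p : Powers M) (h₁ h₂ : Fin N → ℂ) (H : Matrix (Fin N) (Fin M) ℂ)
    (W : Matrix (Fin N) (Fin N) ℂ) : Prop :=
  IsZFAdmissible p h₁ h₂ H W ∧
    ∀ W', IsZFAdmissible p h₁ h₂ H W' → sinr p h₁ h₂ H W' ≤ sinr p h₁ h₂ H W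

end

end AFRelay

/-!
A zero-forcing combining vector annihilates the interference, so the SINR of an admissible
precoder depends on the combining vector `w` only through `x = ‖w h₁‖²`: the power constraint
fixes the amplification, and the SINR equals `ρ₁ ρ₂ x y / (ρ₂ y + ρ₁ x + 1)` with `y = ‖h₂‖²`
(`sinr_eq_zfSinr`). This is increasing in `x`. Almost surely the columns of `H` are linearly
independent; then `P = 1 - H (Hᴴ H)⁻¹ Hᴴ` is the orthogonal projection onto the complement of
the column space of `H`, every unit `w` with `w H = 0` satisfies `‖w h₁‖² ≤ ‖P h₁‖²` by
Cauchy-Schwarz, and equality is attained. Hence a maximizing precoder exists, and the SINR of any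
maximizing precoder is the value above at `x = ‖P h₁‖²` (`IsZFMRT.sinr_eq`).

The law `CN(0,1)^N` is invariant under unitary matrices (`measurePreserving_unitary_mulVec`), so
diagonalizing `P`, of rank `N - M`, shows that for fixed `H` the variable `‖P h₁‖²` is a sum of
`N - M` independent standard exponentials, that is, Gamma distributed with shape `N - M`
(`hasLaw_normSq_projection`). Likewise `‖h₂‖²` is Gamma distributed with shape `N`. By Fubini
the probability of no outage is the average over `y` of the tail of the first law at the threshold
`γ (ρ₂ y + 1) / (ρ₁ (ρ₂ y - γ))`, restricted to `y > γ / ρ₂` (`measure_zfSinr_ge`).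

The tail is `e^(-t)` times a truncated exponential series. After the shift `y = z + γ / ρ₂` two
binomial expansions turn the integrand into a combination of the functions
`z^(ν - 1) e^(-(z + b / z))` with `b = (1 + γ) γ / (ρ₁ ρ₂)`, and the substitution `z = √b e^s`
evaluates their integrals as `2 b^(ν / 2) K_ν(2 √b)` (`integral_rpow_mul_exp_neg_add_div`).
-/

namespace AFRelay

open Set

/-! ### A Bessel integral and the tail of the Gamma law -/

/-- At the origin the factor `e^(-b/z)` beats every power of `1/z`, so the order `ν` is
unrestricted. -/
theorem integrableOn_rpow_mul_exp_neg_add_div (ν : ℝ) {b : ℝ} (hb : 0 < b) :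
    IntegrableOn (fun z : ℝ => z ^ (ν - 1) * Real.exp (-(z + b / z))) (Ioi 0) := by
  -- The bound `e^(-b/z) ≤ n! (z/b)^n` with `n > -ν` reduces to the Gamma integral of order `ν + n`.
  obtain ⟨n, hn⟩ := exists_nat_gt (-ν)
  have hs : 0 < ν + n := by linarith
  refine ((Real.GammaIntegral_convergent hs).const_mul (n.factorial / b ^ n)).mono' ?_ ?_
  · exact (by fun_prop : Measurable _).aestronglyMeasurable
  · refine (ae_restrict_iff' measurableSet_Ioi).2 (ae_of_all _ fun z hz => ?_)
    have hz : 0 < z := hz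
    have h1 := Real.pow_div_factorial_le_exp (b / z) (by positivity) n
    have h2 : Real.exp (-(b / z)) ≤ n.factorial / b ^ n * z ^ n := by
      rw [Real.exp_neg]
      refine (inv_anti₀ (by positivity) h1).trans (le_of_eq ?_)
      field_simp
      rw [← mul_pow, div_mul_cancel₀ _ hz.ne']
    rw [Real.norm_of_nonneg (by positivity), neg_add, Real.exp_add]
    have h3 : z ^ (ν + n - 1) = z ^ (ν - 1) * z ^ n := by
      rw [← Real.rpow_natCast, ← Real.rpow_add hz]; ring_nf
    rw [h3]
    calc z ^ (ν - 1) * (Real.exp (-z) * Real.exp (-(b / z)))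
        ≤ z ^ (ν - 1) * (Real.exp (-z) * (n.factorial / b ^ n * z ^ n)) := by gcongr
      _ = _ := by ring

/-- An integral representation of the Bessel function `K_ν`, by the substitution `z = √b e^s`. -/
theorem integral_rpow_mul_exp_neg_add_div (ν : ℝ) {b : ℝ} (hb : 0 < b) :
    ∫ z in Ioi (0 : ℝ), z ^ (ν - 1) * Real.exp (-(z + b / z)) =
      2 * b ^ (ν / 2) * besselK ν (2 * Real.sqrt b) := by
  have hr : 0 < Real.sqrt b := Real.sqrt_pos.2 hb
  have himg : (fun s : ℝ => Real.sqrt b * Real.exp s) '' univ = Ioi 0 := by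
    ext z
    simp only [image_univ, mem_range, mem_Ioi]
    constructor
    · rintro ⟨s, rfl⟩; positivity
    · intro hz
      exact ⟨Real.log (z / Real.sqrt b), by rw [Real.exp_log (by positivity)]; field_simp⟩
  have hder : ∀ s ∈ (univ : Set ℝ), HasDerivWithinAt (fun s : ℝ => Real.sqrt b * Real.exp s)
      (Real.sqrt b * Real.exp s) univ s := fun s _ =>
    ((Real.hasDerivAt_exp s).const_mul _).hasDerivWithinAt
  have hinj : InjOn (fun s : ℝ => Real.sqrt b * Real.exp s) univ := by
    intro s _ t _ h
    exact Real.exp_injective (mul_left_cancel₀ hr.ne' h)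
  have hfun : ∀ s : ℝ, |Real.sqrt b * Real.exp s| • ((Real.sqrt b * Real.exp s) ^ (ν - 1) *
      Real.exp (-(Real.sqrt b * Real.exp s + b / (Real.sqrt b * Real.exp s)))) =
      b ^ (ν / 2) * (Real.exp (ν * s) * Real.exp (-(2 * Real.sqrt b) * Real.cosh s)) := by
    intro s
    have hp : 0 < Real.sqrt b * Real.exp s := by positivity
    rw [abs_of_pos hp, smul_eq_mul, ← mul_assoc]
    have e1 : Real.sqrt b * Real.exp s * (Real.sqrt b * Real.exp s) ^ (ν - 1) =
        b ^ (ν / 2) * Real.exp (ν * s) := by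
      rw [Real.rpow_sub_one hp.ne', mul_div_cancel₀ _ hp.ne',
        Real.mul_rpow hr.le (Real.exp_pos s).le, Real.sqrt_eq_rpow, ← Real.rpow_mul hb.le,
        ← Real.exp_mul]
      ring_nf
    have e2 : b / (Real.sqrt b * Real.exp s) = Real.sqrt b * Real.exp (-s) := by
      rw [Real.exp_neg]
      field_simp
      exact (Real.sq_sqrt hb.le).symm
    rw [e1, e2, Real.cosh_eq, mul_assoc]
    congr 3
    ring
  have hint := integrableOn_rpow_mul_exp_neg_add_div ν hb
  rw [← himg] at hint ⊢
  rw [integrableOn_image_iff_integrableOn_abs_deriv_smul MeasurableSet.univ hder hinj] at hint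
  rw [integral_image_eq_integral_abs_deriv_smul MeasurableSet.univ hder hinj]
  simp only [hfun] at hint ⊢
  rw [integral_const_mul]
  have hint' : Integrable fun s : ℝ =>
      Real.exp (ν * s) * Real.exp (-(2 * Real.sqrt b) * Real.cosh s) := by
    rw [integrableOn_univ] at hint
    refine (hint.const_mul (b ^ (ν / 2))⁻¹).congr (ae_of_all _ fun s => ?_)
    have : b ^ (ν / 2) ≠ 0 := (Real.rpow_pos_of_pos hb _).ne'
    simp only []
    field_simp
  have hneg : IntegrableOn (fun s : ℝ =>
      Real.exp (ν * -s) * Real.exp (-(2 * Real.sqrt b) * Real.cosh (-s))) (Ioi 0) :=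
    hint'.comp_neg.integrableOn
  -- Folding the line onto the half-line symmetrizes `e^(ν s)` into `2 cosh (ν s)`.
  rw [setIntegral_univ, ← intervalIntegral.integral_Iic_add_Ioi (b := 0) hint'.integrableOn
    hint'.integrableOn, ← neg_zero, ← integral_comp_neg_Ioi, neg_zero,
    ← integral_add hneg hint'.integrableOn, mul_comm 2 (b ^ (ν / 2)), mul_assoc, besselK]
  congr 1
  rw [← integral_const_mul]
  refine setIntegral_congr_fun measurableSet_Ioi fun s _ => ?_
  simp only [Real.cosh_neg, Real.cosh_eq (ν * s)]
  ring_nf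

/-- The tail of the Gamma law of integer shape: minus the right-hand side, as a function of `t`, is
an antiderivative of the density. -/
theorem integral_Ioi_pow_div_factorial_mul_exp_neg (k : ℕ) (t : ℝ) (ht : 0 ≤ t) :
    IntegrableOn (fun x : ℝ => x ^ k / k.factorial * Real.exp (-x)) (Ioi t) ∧
    ∫ x in Ioi t, x ^ k / k.factorial * Real.exp (-x) =
      Real.exp (-t) * ∑ m ∈ Finset.range (k + 1), t ^ m / m.factorial := by
  have hder : ∀ x ∈ Ici t, HasDerivAt
      (fun x : ℝ => -(Real.exp (-x) * ∑ m ∈ Finset.range (k + 1), x ^ m / m.factorial))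
      (x ^ k / k.factorial * Real.exp (-x)) x := by
    intro x _
    have h1 : HasDerivAt (fun x : ℝ => ∑ m ∈ Finset.range (k + 1), x ^ m / m.factorial)
        (∑ m ∈ Finset.range k, x ^ m / m.factorial) x := by
      have := HasDerivAt.fun_sum (u := Finset.range (k + 1)) (x := x)
        (A := fun m (x : ℝ) => x ^ m / m.factorial)
        (fun m _ => (hasDerivAt_pow m x).div_const (m.factorial : ℝ))
      refine this.congr_deriv ?_
      rw [Finset.sum_range_succ']
      simp only [Nat.cast_zero, zero_mul, zero_div, add_zero]
      refine Finset.sum_congr rfl fun m _ => ?_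
      rw [Nat.factorial_succ]
      push_cast
      have : ((m : ℝ) + 1) ≠ 0 := by positivity
      field_simp
    have h2 := (((Real.hasDerivAt_exp (-x)).comp x (hasDerivAt_neg x)).mul h1).neg
    refine HasDerivAt.congr_deriv (f := fun x : ℝ =>
      -(Real.exp (-x) * ∑ m ∈ Finset.range (k + 1), x ^ m / m.factorial)) h2 ?_
    rw [Finset.sum_range_succ]
    simp only [Function.comp]
    ring
  have hlim : Filter.Tendsto
      (fun x : ℝ => -(Real.exp (-x) * ∑ m ∈ Finset.range (k + 1), x ^ m / m.factorial))
      Filter.atTop (nhds 0) := by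
    have : ∀ m ∈ Finset.range (k + 1), Filter.Tendsto
        (fun x : ℝ => x ^ m * Real.exp (-x) / m.factorial) Filter.atTop (nhds (0 / m.factorial)) :=
      fun m _ => (Real.tendsto_pow_mul_exp_neg_atTop_nhds_zero m).div_const _
    have := (tendsto_finsetSum _ this).neg
    simp only [zero_div, Finset.sum_const_zero, neg_zero] at this
    refine this.congr fun x => ?_
    rw [Finset.mul_sum]
    congr 1
    exact Finset.sum_congr rfl fun m _ => by ring
  have hnn : ∀ x ∈ Ioi t, 0 ≤ x ^ k / k.factorial * Real.exp (-x) := fun x hx => by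
    have : 0 < x := ht.trans_lt hx
    positivity
  refine ⟨integrableOn_Ioi_deriv_of_nonneg' hder hnn hlim, ?_⟩
  rw [integral_Ioi_of_hasDerivAt_of_nonneg' hder hnn hlim]
  ring

theorem gammaMeasure_natCast_add_one (k : ℕ) :
    gammaMeasure (k + 1) 1 = (volume.restrict (Ioi 0)).withDensity
      (fun x => ENNReal.ofReal (x ^ k / k.factorial * Real.exp (-x))) := by
  rw [gammaMeasure, ← withDensity_indicator measurableSet_Ioi]
  refine withDensity_congr_ae ?_
  have h0 : ∀ᵐ x : ℝ, x ≠ 0 := by simp [ae_iff]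
  filter_upwards [h0] with x hx
  rcases lt_or_gt_of_ne hx with h | h
  · rw [gammaPDF_of_neg h, indicator_of_notMem (by simpa using h.le)]
  · rw [gammaPDF_of_nonneg h.le, indicator_of_mem (by simpa using h), Real.Gamma_nat_eq_factorial]
    simp only [Real.one_rpow, add_sub_cancel_right, Real.rpow_natCast, one_mul]
    ring_nf

theorem gammaMeasure_Ici (k : ℕ) (t : ℝ) (ht : 0 ≤ t) :
    gammaMeasure (k + 1) 1 (Ici t) = ENNReal.ofReal
      (Real.exp (-t) * ∑ m ∈ Finset.range (k + 1), t ^ m / m.factorial) := by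
  obtain ⟨h1, h2⟩ := integral_Ioi_pow_div_factorial_mul_exp_neg k t ht
  rw [← h2, gammaMeasure_natCast_add_one, withDensity_apply _ measurableSet_Ici,
    Measure.restrict_restrict measurableSet_Ici, ofReal_integral_eq_lintegral_ofReal h1]
  · refine setLIntegral_congr ?_
    have h0 : ∀ᵐ x : ℝ, x ≠ t := by simp [ae_iff]
    filter_upwards [h0] with x hx
    refine propext ⟨fun h => lt_of_le_of_ne h.1 hx.symm, fun h => ⟨le_of_lt h, ht.trans_lt h⟩⟩
  · refine (ae_restrict_iff' measurableSet_Ioi).2 (ae_of_all _ fun x hx => ?_)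
    have : 0 < x := ht.trans_lt hx
    simp only [Pi.zero_apply]
    positivity

/-! ### The Bessel expansion of the averaged Gamma tail -/

/-- Pointwise expansion, at `y = z + γ / ρ₂`, of the product of the tail of an Erlang variable of
shape `n`, taken at the threshold `γ (ρ₂ y + 1) / (ρ₁ (ρ₂ y - γ))`, with the Gamma density of
shape `K + 1`. The threshold is `(γ / ρ₁) (y + 1 / ρ₂) / z`; its powers are expanded in `y`, and
the resulting powers of `y` in `z`. -/
theorem erlang_tail_mul_density_expansion (K n : ℕ) {ρ₁ ρ₂ γ z : ℝ} (hρ₁ : 0 < ρ₁) (hρ₂ : 0 < ρ₂)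
    (hz : 0 < z) :
    Real.exp (-(γ * (ρ₂ * (z + γ / ρ₂) + 1) / (ρ₁ * (ρ₂ * (z + γ / ρ₂) - γ)))) *
      (∑ m ∈ Finset.range n,
        (γ * (ρ₂ * (z + γ / ρ₂) + 1) / (ρ₁ * (ρ₂ * (z + γ / ρ₂) - γ))) ^ m / m.factorial) *
      ((z + γ / ρ₂) ^ K / K.factorial * Real.exp (-(z + γ / ρ₂))) =
    Real.exp (-(γ / ρ₁) - γ / ρ₂) / K.factorial *
      ∑ m ∈ Finset.range n, (γ / ρ₁) ^ m * (1 / (m.factorial : ℝ)) *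
        ∑ j ∈ Finset.range (m + 1), (m.choose j : ℝ) * (1 / ρ₂) ^ (m - j) *
          ∑ k ∈ Finset.range (K + j + 1), ((K + j).choose k : ℝ) * (γ / ρ₂) ^ (K + j - k) *
            (z ^ ((k : ℝ) - m + 1 - 1) * Real.exp (-(z + (1 + γ) * γ / (ρ₁ * ρ₂) / z))) := by
  have ht : γ * (ρ₂ * (z + γ / ρ₂) + 1) / (ρ₁ * (ρ₂ * (z + γ / ρ₂) - γ)) =
      γ / ρ₁ * (((z + γ / ρ₂) + 1 / ρ₂) / z) := by
    have : ρ₂ * (z + γ / ρ₂) - γ = ρ₂ * z := by field_simp; ring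
    rw [this]; field_simp
  have hexp : Real.exp (-(γ / ρ₁ * (((z + γ / ρ₂) + 1 / ρ₂) / z))) * Real.exp (-(z + γ / ρ₂)) =
      Real.exp (-(γ / ρ₁) - γ / ρ₂) * Real.exp (-(z + (1 + γ) * γ / (ρ₁ * ρ₂) / z)) := by
    rw [← Real.exp_add, ← Real.exp_add]
    congr 1
    field_simp
    ring
  rw [ht]
  set E := Real.exp (-(z + (1 + γ) * γ / (ρ₁ * ρ₂) / z)) with hE
  set c := γ / ρ₂
  have hterm : ∀ m : ℕ, (γ / ρ₁ * ((z + c + 1 / ρ₂) / z)) ^ m / m.factorial * (z + c) ^ K * E =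
      (γ / ρ₁) ^ m * (1 / (m.factorial : ℝ)) *
        ∑ j ∈ Finset.range (m + 1), (m.choose j : ℝ) * (1 / ρ₂) ^ (m - j) *
          ∑ k ∈ Finset.range (K + j + 1), ((K + j).choose k : ℝ) * c ^ (K + j - k) *
            (z ^ ((k : ℝ) - m + 1 - 1) * E) := by
    intro m
    have hz' : ∀ k : ℕ, z ^ ((k : ℝ) - m + 1 - 1) = z ^ k / z ^ m := fun k => by
      rw [add_sub_cancel_right, Real.rpow_sub hz, Real.rpow_natCast, Real.rpow_natCast]
    have hk : ∀ j : ℕ, ∑ k ∈ Finset.range (K + j + 1), ((K + j).choose k : ℝ) * c ^ (K + j - k) *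
        (z ^ ((k : ℝ) - m + 1 - 1) * E) = (z + c) ^ K * (z + c) ^ j * (E / z ^ m) := by
      intro j
      rw [← pow_add, add_pow, Finset.sum_mul]
      refine Finset.sum_congr rfl fun k _ => ?_
      rw [hz']; ring
    simp only [hk]
    rw [mul_pow, div_pow (z + c + 1 / ρ₂) z, add_pow (z + c)]
    simp only [Finset.sum_div, Finset.mul_sum, Finset.sum_mul]
    exact Finset.sum_congr rfl fun j _ => by ring
  calc _ = (Real.exp (-(γ / ρ₁ * ((z + c + 1 / ρ₂) / z))) * Real.exp (-(z + c))) / K.factorial *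
        ((∑ m ∈ Finset.range n, (γ / ρ₁ * ((z + c + 1 / ρ₂) / z)) ^ m / m.factorial) *
          (z + c) ^ K) := by ring
    _ = Real.exp (-(γ / ρ₁) - c) / K.factorial *
        ∑ m ∈ Finset.range n, (γ / ρ₁ * ((z + c + 1 / ρ₂) / z)) ^ m / m.factorial *
          (z + c) ^ K * E := by
      rw [hexp, ← Finset.sum_mul, ← Finset.sum_mul]; ring
    _ = _ := by simp only [hterm]

/-- The probability of no outage as a closed form: averaging the tail `P(X ≥ t)` of an Erlang
variable of shape `n` over the Gamma law of shape `N`, at the threshold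
`t = γ (ρ₂ y + 1) / (ρ₁ (ρ₂ y - γ))`. -/
theorem lintegral_erlang_tail_gammaMeasure {N : ℕ} (hN : 0 < N) (n : ℕ) {ρ₁ ρ₂ γ : ℝ}
    (hρ₁ : 0 < ρ₁) (hρ₂ : 0 < ρ₂) (hγ : 0 < γ) :
    ∃ r : ℝ, 0 ≤ r ∧
      r = 2 * Real.exp (-(γ / ρ₁) - γ / ρ₂) / Real.Gamma N *
          ∑ m ∈ Finset.range n, (γ / ρ₁) ^ m * (1 / (m.factorial : ℝ)) *
            ∑ j ∈ Finset.range (m + 1), (m.choose j : ℝ) * (1 / ρ₂) ^ (m - j) *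
              ∑ k ∈ Finset.range (N + j), ((N + j - 1).choose k : ℝ) *
                (γ / ρ₂) ^ (N + j - 1 - k) *
                ((1 + γ) * γ / (ρ₁ * ρ₂)) ^ (((k : ℝ) - m + 1) / 2) *
                besselK ((k : ℝ) - m + 1)
                  (2 * Real.sqrt ((1 + γ) * γ / (ρ₁ * ρ₂))) ∧
      ∫⁻ y in Ioi (γ / ρ₂), ENNReal.ofReal
        (Real.exp (-(γ * (ρ₂ * y + 1) / (ρ₁ * (ρ₂ * y - γ)))) *
          ∑ m ∈ Finset.range n, (γ * (ρ₂ * y + 1) / (ρ₁ * (ρ₂ * y - γ))) ^ m / m.factorial)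
        ∂(gammaMeasure N 1) = ENNReal.ofReal r := by
  obtain ⟨K, rfl⟩ : ∃ K, N = K + 1 := ⟨N - 1, by omega⟩
  have hc : 0 < γ / ρ₂ := by positivity
  have hb : 0 < (1 + γ) * γ / (ρ₁ * ρ₂) := by positivity
  -- the integrand after the shift `y = z + γ / ρ₂`
  set G : ℝ → ℝ := fun z => Real.exp (-(γ / ρ₁) - γ / ρ₂) / K.factorial *
      ∑ m ∈ Finset.range n, (γ / ρ₁) ^ m * (1 / (m.factorial : ℝ)) *
        ∑ j ∈ Finset.range (m + 1), (m.choose j : ℝ) * (1 / ρ₂) ^ (m - j) *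
          ∑ k ∈ Finset.range (K + j + 1), ((K + j).choose k : ℝ) * (γ / ρ₂) ^ (K + j - k) *
            (z ^ ((k : ℝ) - m + 1 - 1) * Real.exp (-(z + (1 + γ) * γ / (ρ₁ * ρ₂) / z))) with hG
  have hint : ∀ k m : ℕ, IntegrableOn (fun z : ℝ => z ^ ((k : ℝ) - m + 1 - 1) *
      Real.exp (-(z + (1 + γ) * γ / (ρ₁ * ρ₂) / z))) (Ioi 0) := fun k m =>
    integrableOn_rpow_mul_exp_neg_add_div _ hb
  have hi1 : ∀ j m : ℕ, Integrable (fun z : ℝ => ∑ k ∈ Finset.range (K + j + 1),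
      ((K + j).choose k : ℝ) * (γ / ρ₂) ^ (K + j - k) * (z ^ ((k : ℝ) - m + 1 - 1) *
        Real.exp (-(z + (1 + γ) * γ / (ρ₁ * ρ₂) / z)))) (volume.restrict (Ioi 0)) := fun j m =>
    integrable_finsetSum _ fun k _ => (hint k m).const_mul _
  have hi2 : ∀ m : ℕ, Integrable (fun z : ℝ => ∑ j ∈ Finset.range (m + 1),
      (m.choose j : ℝ) * (1 / ρ₂) ^ (m - j) * ∑ k ∈ Finset.range (K + j + 1),
      ((K + j).choose k : ℝ) * (γ / ρ₂) ^ (K + j - k) * (z ^ ((k : ℝ) - m + 1 - 1) *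
        Real.exp (-(z + (1 + γ) * γ / (ρ₁ * ρ₂) / z)))) (volume.restrict (Ioi 0)) := fun m =>
    integrable_finsetSum _ fun j _ => (hi1 j m).const_mul _
  have hGi : Integrable G (volume.restrict (Ioi 0)) :=
    (integrable_finsetSum _ fun m _ => (hi2 m).const_mul _).const_mul _
  have hG0 : ∀ z ∈ Ioi (0 : ℝ), 0 ≤ G z := fun z hz => by
    have hz : 0 < z := hz
    simp only [hG]
    positivity
  refine ⟨∫ z in Ioi 0, G z, setIntegral_nonneg measurableSet_Ioi hG0, ?_, ?_⟩
  · simp only [hG]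
    rw [integral_const_mul, integral_finsetSum _ fun m _ => (hi2 m).const_mul _]
    push_cast
    rw [Real.Gamma_nat_eq_factorial, mul_comm (2 : ℝ) (Real.exp _),
      mul_div_right_comm (Real.exp _) 2, mul_assoc (Real.exp _ / _) 2]
    congr 1
    rw [Finset.mul_sum]
    refine Finset.sum_congr rfl fun m _ => ?_
    rw [integral_const_mul, integral_finsetSum _ fun j _ => (hi1 j m).const_mul _,
      mul_left_comm]
    congr 1
    rw [Finset.mul_sum]
    refine Finset.sum_congr rfl fun j _ => ?_
    rw [integral_const_mul, integral_finsetSum _ fun k _ => (hint k m).const_mul _,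
      mul_left_comm]
    congr 1
    have h1 : K + 1 + j = K + j + 1 := by omega
    rw [Finset.mul_sum, h1, add_tsub_cancel_right]
    refine Finset.sum_congr rfl fun k _ => ?_
    rw [integral_const_mul, integral_rpow_mul_exp_neg_add_div _ hb]
    ring
  · rw [ofReal_integral_eq_lintegral_ofReal hGi
      ((ae_restrict_iff' measurableSet_Ioi).2 (ae_of_all _ hG0))]
    push_cast
    rw [gammaMeasure_natCast_add_one, restrict_withDensity measurableSet_Ioi,
      Measure.restrict_restrict measurableSet_Ioi, inter_eq_left.2 (Ioi_subset_Ioi hc.le),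
      lintegral_withDensity_eq_lintegral_mul _ (by fun_prop) (by fun_prop),
      ← lintegral_indicator measurableSet_Ioi, ← lintegral_indicator measurableSet_Ioi,
      ← lintegral_add_right_eq_self _ (γ / ρ₂)]
    refine lintegral_congr fun z => ?_
    by_cases hz : 0 < z
    · rw [indicator_of_mem (by simpa using hz), indicator_of_mem (by simpa using hz), Pi.mul_apply,
        ← ENNReal.ofReal_mul (by positivity)]
      congr 1
      simp only [hG]
      rw [← erlang_tail_mul_density_expansion K n hρ₁ hρ₂ hz]
      ring
    · rw [indicator_of_notMem (by simpa using hz), indicator_of_notMem (by simpa using hz)]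

/-! ### Sums of independent exponential variables -/

/-- Adding an independent standard exponential variable raises the shape by one. -/
theorem gammaMeasure_conv_exponential (k : ℕ) :
    (gammaMeasure (k + 1) 1).conv (gammaMeasure 1 1) = gammaMeasure (k + 2) 1 := by
  have h1 : gammaMeasure 1 1 = (volume.restrict (Ioi 0)).withDensity
      (fun x => ENNReal.ofReal (Real.exp (-x))) := by
    simpa using gammaMeasure_natCast_add_one 0
  have h2 : gammaMeasure ((k : ℝ) + 2) 1 = (volume.restrict (Ioi 0)).withDensity
      (fun x => ENNReal.ofReal (x ^ (k + 1) / (k + 1).factorial * Real.exp (-x))) := by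
    rw [← gammaMeasure_natCast_add_one]; congr 1; push_cast; ring
  refine Measure.ext_of_lintegral _ fun f hf => ?_
  rw [h1, h2, gammaMeasure_natCast_add_one, Measure.lintegral_conv hf,
    lintegral_withDensity_eq_lintegral_mul _ (by fun_prop) (by fun_prop),
    lintegral_withDensity_eq_lintegral_mul _ (by fun_prop) hf]
  have hin : ∀ x : ℝ, ∫⁻ y, f (x + y) ∂((volume.restrict (Ioi 0)).withDensity
      (fun x => ENNReal.ofReal (Real.exp (-x)))) =
      ∫⁻ s, (Ioi x).indicator (fun s => ENNReal.ofReal (Real.exp (-(s - x))) * f s) s := by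
    intro x
    rw [lintegral_withDensity_eq_lintegral_mul _ (by fun_prop) (by fun_prop),
      ← lintegral_indicator measurableSet_Ioi]
    conv_rhs => rw [← lintegral_add_right_eq_self _ x]
    refine lintegral_congr fun y => ?_
    by_cases hy : 0 < y
    · rw [indicator_of_mem (by simpa using hy), indicator_of_mem (by simpa using hy)]
      simp [add_comm]
    · rw [indicator_of_notMem (by simpa using hy), indicator_of_notMem (by simpa using hy)]
  simp only [Pi.mul_apply, hin]
  have hm : Measurable (Function.uncurry fun x s : ℝ =>
      ENNReal.ofReal (x ^ k / k.factorial * Real.exp (-x)) *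
        (Ioi x).indicator (fun s => ENNReal.ofReal (Real.exp (-(s - x))) * f s) s) := by
    refine Measurable.mul (by fun_prop) ?_
    have : (fun p : ℝ × ℝ =>
        (Ioi p.1).indicator (fun s => ENNReal.ofReal (Real.exp (-(s - p.1))) * f s) p.2) =
        {p : ℝ × ℝ | p.1 < p.2}.indicator
          (fun p => ENNReal.ofReal (Real.exp (-(p.2 - p.1))) * f p.2) := by
      ext p; simp [indicator]
    rw [this]
    exact Measurable.indicator (by fun_prop) (measurableSet_lt measurable_fst measurable_snd)
  calc _ = ∫⁻ x in Ioi 0, ∫⁻ s, ENNReal.ofReal (x ^ k / k.factorial * Real.exp (-x)) *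
        (Ioi x).indicator (fun s => ENNReal.ofReal (Real.exp (-(s - x))) * f s) s := by
        refine lintegral_congr fun x => ?_
        rw [lintegral_const_mul]
        exact Measurable.indicator (by fun_prop) measurableSet_Ioi
    _ = ∫⁻ s, ∫⁻ x in Ioi 0, ENNReal.ofReal (x ^ k / k.factorial * Real.exp (-x)) *
        (Ioi x).indicator (fun s => ENNReal.ofReal (Real.exp (-(s - x))) * f s) s :=
        lintegral_lintegral_swap hm.aemeasurable
    _ = ∫⁻ s, (Ioi 0).indicator (fun s => ENNReal.ofReal
          (s ^ (k + 1) / (k + 1).factorial * Real.exp (-s)) * f s) s := by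
        refine lintegral_congr fun s => ?_
        by_cases hs : 0 < s
        · rw [indicator_of_mem (by simpa using hs)]
          calc _ = ∫⁻ x in Ioi 0, (Iio s).indicator (fun x => ENNReal.ofReal
                (x ^ k / k.factorial) * (ENNReal.ofReal (Real.exp (-s)) * f s)) x := by
                refine setLIntegral_congr_fun measurableSet_Ioi fun x hx => ?_
                have hx : 0 < x := hx
                by_cases hxs : x < s
                · simp only [indicator_of_mem (show s ∈ Ioi x from hxs),
                    indicator_of_mem (show x ∈ Iio s from hxs)]
                  rw [← mul_assoc, ← mul_assoc, ← ENNReal.ofReal_mul (by positivity),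
                    ← ENNReal.ofReal_mul (by positivity), mul_assoc, ← Real.exp_add]
                  ring_nf
                · simp only [indicator_of_notMem (show s ∉ Ioi x from hxs),
                    indicator_of_notMem (show x ∉ Iio s from hxs), mul_zero]
            _ = (∫⁻ x in Ioo 0 s, ENNReal.ofReal (x ^ k / k.factorial)) *
                (ENNReal.ofReal (Real.exp (-s)) * f s) := by
                rw [lintegral_indicator measurableSet_Iio,
                  Measure.restrict_restrict measurableSet_Iio, inter_comm, Ioi_inter_Iio,
                  lintegral_mul_const _ (by fun_prop)]
            _ = _ := by
                have hi : IntegrableOn (fun x : ℝ => x ^ k / k.factorial) (Ioo 0 s) :=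
                  (Continuous.integrableOn_Icc (by fun_prop)).mono_set Ioo_subset_Icc_self
                rw [← ofReal_integral_eq_lintegral_ofReal hi, ← integral_Ioc_eq_integral_Ioo,
                  ← intervalIntegral.integral_of_le hs.le, intervalIntegral.integral_div,
                  integral_pow, ← mul_assoc, ← ENNReal.ofReal_mul]
                · congr 3
                  rw [Nat.factorial_succ]
                  push_cast
                  field_simp
                  simp
                · have : (0 : ℝ) ^ (k + 1) = 0 := by simp
                  rw [this, sub_zero]
                  positivity
                · refine (ae_restrict_iff' measurableSet_Ioo).2 (ae_of_all _ fun x hx => ?_)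
                  have := hx.1
                  simp only [Pi.zero_apply]
                  positivity
        · rw [indicator_of_notMem (by simpa using hs)]
          rw [← lintegral_zero (μ := volume.restrict (Ioi (0 : ℝ)))]
          refine setLIntegral_congr_fun measurableSet_Ioi fun x hx => ?_
          have hx : 0 < x := hx
          simp only [indicator_of_notMem (show s ∉ Ioi x from fun h => hs (hx.trans h)), mul_zero]
    _ = _ := by rw [lintegral_indicator measurableSet_Ioi]

theorem hasLaw_sum_gammaMeasure {Ω ι : Type*} [MeasurableSpace Ω] {μ : Measure Ω}
    [IsProbabilityMeasure μ]
    {X : ι → Ω → ℝ} (hX : ∀ i, HasLaw (X i) (gammaMeasure 1 1) μ) (hind : iIndepFun X μ)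
    (s : Finset ι) (hs : s.Nonempty) :
    HasLaw (∑ i ∈ s, X i) (gammaMeasure s.card 1) μ := by
  classical
  induction hs using Finset.Nonempty.cons_induction with
  | singleton i => simpa using hX i
  | cons i s hi hs ih =>
    obtain ⟨k, hk⟩ : ∃ k, s.card = k + 1 := ⟨s.card - 1, by have := hs.card_pos; omega⟩
    have h := hind.indepFun_finsetSum_of_notMem₀ (fun i => (hX i).aemeasurable) hi
    rw [hk] at ih
    have : IsProbabilityMeasure (gammaMeasure 1 1) :=
      isProbabilityMeasure_gammaMeasure one_pos one_pos
    have : IsProbabilityMeasure (gammaMeasure ((k + 1 : ℕ) : ℝ) 1) :=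
      isProbabilityMeasure_gammaMeasure (by positivity) one_pos
    have h2 := h.hasLaw_add ih (hX i)
    rw [Finset.sum_cons, Finset.card_cons, hk, add_comm (X i)]
    push_cast at h2 ⊢
    rw [gammaMeasure_conv_exponential] at h2
    convert h2 using 2
    ring

/-! ### The complex Gaussian law -/

instance isProbabilityMeasure_stdComplexGaussian : IsProbabilityMeasure stdComplexGaussian :=
  Measure.isProbabilityMeasure_map
    (Complex.measurableEquivRealProd.symm.measurable.aemeasurable)

theorem lintegral_stdComplexGaussian {f : ℂ → ENNReal} (hf : Measurable f) :
    ∫⁻ z, f z ∂stdComplexGaussian = ∫⁻ p : ℝ × ℝ,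
      ENNReal.ofReal (Real.exp (-(p.1 ^ 2 + p.2 ^ 2)) / Real.pi) * f ⟨p.1, p.2⟩ := by
  have hmk : Measurable (fun p : ℝ × ℝ => (⟨p.1, p.2⟩ : ℂ)) :=
    Complex.measurableEquivRealProd.symm.measurable
  rw [stdComplexGaussian, lintegral_map hf hmk,
    gaussianReal_of_var_ne_zero _ (by norm_num),
    prod_withDensity (measurable_gaussianPDF _ _) (measurable_gaussianPDF _ _)]
  refine (lintegral_withDensity_eq_lintegral_mul _ (((measurable_gaussianPDF _ _).comp
    measurable_fst).mul ((measurable_gaussianPDF _ _).comp measurable_snd)) (hf.comp hmk)).trans ?_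
  refine lintegral_congr fun p => ?_
  simp only [Pi.mul_apply, Function.comp, gaussianPDF]
  rw [← ENNReal.ofReal_mul (gaussianPDFReal_nonneg _ _ _)]
  congr 2
  simp only [gaussianPDFReal, sub_zero]
  have h : (2 * Real.pi * ((1 / 2 : ℝ≥0) : ℝ)) = Real.pi := by push_cast; ring
  have h' : (2 * ((1 / 2 : ℝ≥0) : ℝ)) = 1 := by push_cast; ring
  rw [h, h', neg_add, Real.exp_add, div_one, div_one]
  have := Real.mul_self_sqrt Real.pi_pos.le
  have h0 := Real.pi_pos
  have h3 : 0 < Real.sqrt Real.pi := Real.sqrt_pos.2 h0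
  calc _ = Real.exp (-p.1 ^ 2) * Real.exp (-p.2 ^ 2) *
        (Real.sqrt Real.pi * Real.sqrt Real.pi)⁻¹ := by rw [mul_inv]; ring
    _ = _ := by rw [this]; rfl

theorem hasLaw_norm_sq_stdComplexGaussian :
    HasLaw (fun z : ℂ => ‖z‖ ^ 2) (gammaMeasure 1 1) stdComplexGaussian := by
  refine ⟨by fun_prop, Measure.ext_of_lintegral _ fun f hf => ?_⟩
  have h1 : gammaMeasure 1 1 = (volume.restrict (Ioi 0)).withDensity
      (fun x => ENNReal.ofReal (Real.exp (-x))) := by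
    simpa using gammaMeasure_natCast_add_one 0
  rw [lintegral_map hf (by fun_prop), lintegral_stdComplexGaussian (by fun_prop),
    ← lintegral_comp_polarCoord_symm, h1,
    lintegral_withDensity_eq_lintegral_mul _ (by fun_prop) hf]
  have himg : (fun r : ℝ => r ^ 2) '' Ioi 0 = Ioi 0 := by
    ext u
    simp only [mem_image, mem_Ioi]
    constructor
    · rintro ⟨r, hr, rfl⟩; positivity
    · intro hu; exact ⟨Real.sqrt u, Real.sqrt_pos.2 hu, Real.sq_sqrt hu.le⟩
  have hinj : InjOn (fun r : ℝ => r ^ 2) (Ioi 0) := fun a ha b hb h => by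
    have ha : 0 < a := ha
    have hb : 0 < b := hb
    exact (pow_left_inj₀ ha.le hb.le two_ne_zero).1 h
  conv_rhs => rw [← himg]
  rw [lintegral_image_eq_lintegral_abs_deriv_mul measurableSet_Ioi
    (fun r _ => (hasDerivAt_pow 2 r).hasDerivWithinAt) hinj, polarCoord_target,
    Measure.volume_eq_prod, setLIntegral_prod]
  · refine setLIntegral_congr_fun measurableSet_Ioi fun r hr => ?_
    have hr : 0 < r := hr
    have hnorm : ∀ θ : ℝ, ‖(⟨r * Real.cos θ, r * Real.sin θ⟩ : ℂ)‖ ^ 2 = r ^ 2 := fun θ => by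
      rw [Complex.sq_norm, Complex.normSq_mk]
      linear_combination r ^ 2 * Real.cos_sq_add_sin_sq θ
    have hsq : ∀ θ : ℝ, (r * Real.cos θ) ^ 2 + (r * Real.sin θ) ^ 2 = r ^ 2 := fun θ => by
      linear_combination r ^ 2 * Real.cos_sq_add_sin_sq θ
    simp only [polarCoord_symm_apply, hnorm, hsq, lintegral_const, Measure.restrict_apply_univ,
      Real.volume_Ioo, smul_eq_mul, Pi.mul_apply]
    rw [mul_right_comm, ← mul_assoc, ← mul_assoc, ← ENNReal.ofReal_mul hr.le,
      ← ENNReal.ofReal_mul (by have := Real.pi_pos; nlinarith),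
      ← ENNReal.ofReal_mul (by positivity)]
    congr 2
    rw [Nat.cast_ofNat, abs_of_pos (by positivity)]
    field_simp
    ring
  · refine Measurable.aemeasurable ?_
    have hmk : Measurable (fun p : ℝ × ℝ => (⟨p.1, p.2⟩ : ℂ)) :=
      Complex.measurableEquivRealProd.symm.measurable
    have hp : Measurable (fun p : ℝ × ℝ => polarCoord.symm p) := by
      simp only [polarCoord_symm_apply]; fun_prop
    simp only [smul_eq_mul]
    have := hmk.comp hp
    refine Measurable.mul (by fun_prop) (Measurable.mul (by fun_prop) (hf.comp ?_))
    exact (measurable_norm.comp this).pow_const 2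

/-! ### Gaussian vectors and their projections -/

/-- The law of a vector of `N` independent `CN(0,1)` entries. -/
noncomputable def gaussianVector (N : ℕ) : Measure (Fin N → ℂ) :=
  Measure.pi fun _ => stdComplexGaussian

instance isProbabilityMeasure_gaussianVector (N : ℕ) :
    IsProbabilityMeasure (gaussianVector N) := by
  unfold gaussianVector; infer_instance

theorem normSq_nonneg {N : ℕ} (v : Fin N → ℂ) : 0 ≤ normSq v :=
  Finset.sum_nonneg fun _ _ => by positivity

theorem normSq_eq_zero {N : ℕ} {v : Fin N → ℂ} : normSq v = 0 ↔ v = 0 := by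
  rw [normSq, Finset.sum_eq_zero_iff_of_nonneg fun _ _ => by positivity]
  simp [funext_iff]

theorem ofReal_normSq {N : ℕ} (v : Fin N → ℂ) : (normSq v : ℂ) = star v ⬝ᵥ v := by
  simp [normSq, dotProduct, Complex.conj_mul']

theorem normSq_smul {N : ℕ} (c : ℂ) (v : Fin N → ℂ) : normSq (c • v) = ‖c‖ ^ 2 * normSq v := by
  simp [normSq, Finset.mul_sum, mul_pow]

theorem normSq_star {N : ℕ} (v : Fin N → ℂ) : normSq (star v) = normSq v := by
  simp [normSq]

@[fun_prop]
theorem measurable_normSq {N : ℕ} : Measurable (normSq (N := N)) := by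
  unfold normSq; fun_prop

theorem charFun_stdComplexGaussian (t : ℂ) :
    charFun stdComplexGaussian t = Complex.exp (-(‖t‖ ^ 2 : ℝ) / 4) := by
  have hmk : Measurable (fun p : ℝ × ℝ => (⟨p.1, p.2⟩ : ℂ)) :=
    Complex.measurableEquivRealProd.symm.measurable
  have hre := charFun_gaussianReal (μ := 0) (v := 1 / 2) t.re
  have him := charFun_gaussianReal (μ := 0) (v := 1 / 2) t.im
  rw [charFun_apply] at hre him
  rw [charFun_apply, stdComplexGaussian, integral_map hmk.aemeasurable (by fun_prop)]
  have h : ∀ p : ℝ × ℝ, Complex.exp (inner ℝ (⟨p.1, p.2⟩ : ℂ) t * Complex.I) =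
      Complex.exp (inner ℝ p.1 t.re * Complex.I) * Complex.exp (inner ℝ p.2 t.im * Complex.I) := by
    intro p
    rw [← Complex.exp_add]
    congr 1
    simp [Complex.inner]
    ring
  simp_rw [h]
  rw [integral_prod_mul (fun x : ℝ => Complex.exp (inner ℝ x t.re * Complex.I))
    (fun x : ℝ => Complex.exp (inner ℝ x t.im * Complex.I)), hre, him, ← Complex.exp_add,
    Complex.sq_norm, Complex.normSq_apply]
  congr 1
  push_cast
  ring

/-- The characteristic function depends on `t` through its norm only, whence unitary invariance. -/
theorem charFun_gaussianVector {N : ℕ} (t : EuclideanSpace ℂ (Fin N)) :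
    charFun ((gaussianVector N).map (WithLp.toLp 2)) t =
      Complex.exp (-(normSq t.ofLp : ℝ) / 4) := by
  have := charFun_pi (μ := fun _ : Fin N => stdComplexGaussian) t
  rw [gaussianVector, this]
  simp_rw [charFun_stdComplexGaussian]
  rw [← Complex.exp_sum, normSq]
  congr 1
  push_cast
  rw [← Finset.sum_div, Finset.sum_neg_distrib]

theorem measurePreserving_unitary_mulVec {N : ℕ} {U : Matrix (Fin N) (Fin N) ℂ}
    (hU : U ∈ unitaryGroup (Fin N) ℂ) :
    MeasurePreserving (fun v => U *ᵥ v) (gaussianVector N) (gaussianVector N) := by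
  have hm : Measurable (fun v : Fin N → ℂ => U *ᵥ v) :=
    Continuous.measurable (by fun_prop)
  refine ⟨hm, ?_⟩
  have : IsProbabilityMeasure ((gaussianVector N).map fun v => U *ᵥ v) :=
    Measure.isProbabilityMeasure_map hm.aemeasurable
  rw [gaussianVector, ← charFun_eq_pi_iff, ← gaussianVector]
  intro t
  have hpi := charFun_gaussianVector t
  rw [gaussianVector, charFun_pi] at hpi
  rw [hpi]
  have hUU : U * Uᴴ = 1 := mem_unitaryGroup_iff.1 hU
  have hn : normSq (Uᴴ *ᵥ t.ofLp) = normSq t.ofLp := by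
    have : ((normSq (Uᴴ *ᵥ t.ofLp) : ℝ) : ℂ) = normSq t.ofLp := by
      rw [ofReal_normSq, ofReal_normSq, star_mulVec, conjTranspose_conjTranspose,
        ← dotProduct_mulVec, mulVec_mulVec, hUU, one_mulVec]
    exact_mod_cast this
  rw [← hn]
  have := charFun_gaussianVector (WithLp.toLp 2 (Uᴴ *ᵥ t.ofLp))
  rw [← this, charFun_apply, charFun_apply, integral_map (by fun_prop) (by fun_prop),
    integral_map hm.aemeasurable (by fun_prop), integral_map (by fun_prop) (by fun_prop)]
  refine integral_congr_ae (ae_of_all _ fun v => ?_)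
  have hin : ∀ x y : Fin N → ℂ, inner ℝ (WithLp.toLp 2 x : EuclideanSpace ℂ (Fin N))
      (WithLp.toLp 2 y) = (star x ⬝ᵥ y).re := fun x y => by
    simp [PiLp.inner_apply, Complex.inner, dotProduct, mul_comm]
  have h2 := hin (U *ᵥ v) t.ofLp
  rw [WithLp.toLp_ofLp] at h2
  simp only []
  rw [h2, hin, star_mulVec, ← dotProduct_mulVec]

theorem hasLaw_sum_norm_sq_gaussianVector {N : ℕ} {s : Finset (Fin N)} (hs : s.Nonempty) :
    HasLaw (fun v : Fin N → ℂ => ∑ i ∈ s, ‖v i‖ ^ 2) (gammaMeasure s.card 1)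
      (gaussianVector N) := by
  have hX : ∀ i : Fin N, HasLaw (fun v : Fin N → ℂ => ‖v i‖ ^ 2) (gammaMeasure 1 1)
      (gaussianVector N) := fun i =>
    hasLaw_norm_sq_stdComplexGaussian.fun_comp
      (measurePreserving_eval (fun _ : Fin N => stdComplexGaussian) i).hasLaw
  have hind : iIndepFun (fun (i : Fin N) (v : Fin N → ℂ) => ‖v i‖ ^ 2) (gaussianVector N) :=
    iIndepFun_pi (X := fun _ (z : ℂ) => ‖z‖ ^ 2) fun _ => by fun_prop
  have := hasLaw_sum_gammaMeasure hX hind s hs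
  convert this using 1
  ext v
  simp

theorem hasLaw_normSq_gaussianVector {N : ℕ} (hN : 0 < N) :
    HasLaw (normSq (N := N)) (gammaMeasure N 1) (gaussianVector N) := by
  have : NeZero N := ⟨hN.ne'⟩
  have h := hasLaw_sum_norm_sq_gaussianVector (Finset.univ_nonempty (α := Fin N))
  rwa [Finset.card_univ, Fintype.card_fin] at h

/-- The squared norm of the projection of a complex Gaussian vector onto a subspace of dimension
`n`; the dimension is the trace of the projection matrix. Diagonalizing `P` by a unitary matrix
reduces to the projection onto `n` coordinates. -/
theorem hasLaw_normSq_projection {N n : ℕ} (hn : 0 < n) {P : Matrix (Fin N) (Fin N) ℂ}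
    (hP : P.IsHermitian) (hPP : P * P = P) (htr : P.trace = n) :
    HasLaw (fun v => normSq (P *ᵥ v)) (gammaMeasure n 1) (gaussianVector N) := by
  classical
  have hev : ∀ i, hP.eigenvalues i = 0 ∨ hP.eigenvalues i = 1 := by
    intro i
    have h1 := hP.mulVec_eigenvectorBasis i
    have h2 : (hP.eigenvalues i * hP.eigenvalues i) • ⇑(hP.eigenvectorBasis i) =
        hP.eigenvalues i • ⇑(hP.eigenvectorBasis i) := by
      rw [mul_smul, ← h1, ← mulVec_smul, ← h1, mulVec_mulVec, hPP]
    have h0 : (⇑(hP.eigenvectorBasis i) : Fin N → ℂ) ≠ 0 :=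
      (WithLp.ofLp_eq_zero 2).ne.2 (hP.eigenvectorBasis.orthonormal.ne_zero i)
    have h3 := smul_left_injective ℝ h0 h2
    rcases eq_or_ne (hP.eigenvalues i) 0 with h | h
    · exact Or.inl h
    · exact Or.inr (mul_left_cancel₀ h (by simpa using h3))
  set s := Finset.univ.filter fun i => hP.eigenvalues i = 1 with hs
  have hind : ∀ i, (hP.eigenvalues i : ℂ) = if hP.eigenvalues i = 1 then 1 else 0 := by
    intro i
    rcases hev i with h | h <;> simp [h]
  have hcard : s.card = n := by
    have h := hP.trace_eq_sum_eigenvalues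
    rw [htr] at h
    have h' : (n : ℂ) = s.card := by
      rw [h, hs, Finset.card_filter]
      push_cast
      exact Finset.sum_congr rfl fun i _ => hind i
    exact_mod_cast h'.symm
  have hne : s.Nonempty := Finset.card_pos.1 (by omega)
  set U : Matrix (Fin N) (Fin N) ℂ := ↑hP.eigenvectorUnitary
  have hU : star U ∈ unitaryGroup (Fin N) ℂ := Unitary.star_mem hP.eigenvectorUnitary.2
  have hlaw := (hasLaw_sum_norm_sq_gaussianVector hne).fun_comp
    (measurePreserving_unitary_mulVec hU).hasLaw
  rw [hcard] at hlaw
  -- the spectral decomposition, whose eigenvalues are the indicators of `s`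
  have hsp : P = U * Matrix.diagonal (RCLike.ofReal ∘ hP.eigenvalues) * star U :=
    hP.spectral_theorem
  have hfun : ∀ v, normSq (P *ᵥ v) = ∑ i ∈ s, ‖(star U *ᵥ v) i‖ ^ 2 := by
    intro v
    have : ((normSq (P *ᵥ v) : ℝ) : ℂ) = ((∑ i ∈ s, ‖(star U *ᵥ v) i‖ ^ 2 : ℝ) : ℂ) := by
      rw [ofReal_normSq, star_mulVec, hP.eq, ← dotProduct_mulVec, mulVec_mulVec, hPP]
      have e : star v ⬝ᵥ P *ᵥ v = star (star U *ᵥ v) ⬝ᵥ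
          (Matrix.diagonal (RCLike.ofReal ∘ hP.eigenvalues) *ᵥ (star U *ᵥ v)) := by
        rw [star_mulVec, star_eq_conjTranspose, conjTranspose_conjTranspose, ← dotProduct_mulVec,
          mulVec_mulVec, mulVec_mulVec, ← star_eq_conjTranspose, ← hsp]
      rw [e, hs, Finset.sum_filter]
      push_cast
      simp only [dotProduct, mulVec_diagonal, Pi.star_apply, Function.comp]
      refine Finset.sum_congr rfl fun i _ => ?_
      have hi := hind i
      change star _ * ((hP.eigenvalues i : ℂ) * _) = _
      rw [hi]
      split_ifs
      · simp [Complex.conj_mul']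
      · simp
    exact_mod_cast this
  simpa only [hfun] using hlaw

variable {N M : ℕ}

/-! ### The projection onto the complement of the interference -/

/-- The orthogonal projection `1 - H (Hᴴ H)⁻¹ Hᴴ` onto the orthogonal complement of the column
space of `H`; it has this meaning when the columns of `H` are linearly independent. -/
noncomputable def zfProjection (H : Matrix (Fin N) (Fin M) ℂ) : Matrix (Fin N) (Fin N) ℂ :=
  1 - H * (Hᴴ * H)⁻¹ * Hᴴ

theorem isHermitian_zfProjection (H : Matrix (Fin N) (Fin M) ℂ) :
    (zfProjection H).IsHermitian := by
  have h : (Hᴴ * H)⁻¹.IsHermitian := (isHermitian_conjTranspose_mul_self H).inv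
  rw [IsHermitian, zfProjection, conjTranspose_sub, conjTranspose_one, conjTranspose_mul,
    conjTranspose_mul, conjTranspose_conjTranspose, h.eq, Matrix.mul_assoc]

theorem zfProjection_mul_self_left {H : Matrix (Fin N) (Fin M) ℂ} (hH : IsUnit (Hᴴ * H).det) :
    zfProjection H * H = 0 := by
  rw [zfProjection, Matrix.sub_mul, Matrix.one_mul, Matrix.mul_assoc, Matrix.mul_assoc,
    nonsing_inv_mul _ hH, Matrix.mul_one, sub_self]

theorem zfProjection_mul_self {H : Matrix (Fin N) (Fin M) ℂ} (hH : IsUnit (Hᴴ * H).det) :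
    zfProjection H * zfProjection H = zfProjection H := by
  conv_lhs => rw [show zfProjection H * zfProjection H =
    zfProjection H * (1 - H * (Hᴴ * H)⁻¹ * Hᴴ) from rfl]
  rw [Matrix.mul_sub, Matrix.mul_one, ← Matrix.mul_assoc, ← Matrix.mul_assoc,
    zfProjection_mul_self_left hH, Matrix.zero_mul, Matrix.zero_mul, sub_zero]

theorem trace_zfProjection {H : Matrix (Fin N) (Fin M) ℂ} (hH : IsUnit (Hᴴ * H).det) :
    (zfProjection H).trace = N - M := by
  rw [zfProjection, trace_sub, trace_one, trace_mul_comm, ← Matrix.mul_assoc,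
    mul_nonsing_inv _ hH, trace_one, Fintype.card_fin, Fintype.card_fin]

/-- The projection fixes every zero-forcing combining vector. -/
theorem vecMul_zfProjection {H : Matrix (Fin N) (Fin M) ℂ} {w : Fin N → ℂ} (hw : w ᵥ* H = 0) :
    w ᵥ* zfProjection H = w := by
  rw [zfProjection, vecMul_sub, vecMul_one, ← vecMul_vecMul, ← vecMul_vecMul, hw, zero_vecMul,
    zero_vecMul, sub_zero]

open scoped ComplexOrder in
theorem isUnit_det_conjTranspose_mul_self {H : Matrix (Fin N) (Fin M) ℂ}
    (hH : LinearIndependent ℂ H.col) : IsUnit (Hᴴ * H).det := by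
  have := PosDef.conjTranspose_mul_self H (mulVec_injective_iff.2 hH)
  exact this.det_pos.ne'.isUnit

/-! ### The optimal zero-forcing precoder -/

/-- The end-to-end SINR as a function of `x = ‖w h₁‖²` and `y = ‖h₂‖²`. -/
noncomputable def zfSinr (ρ₁ ρ₂ x y : ℝ) : ℝ := ρ₁ * ρ₂ * x * y / (ρ₂ * y + ρ₁ * x + 1)

theorem zfSinr_mono {ρ₁ ρ₂ x x' y : ℝ} (hρ₁ : 0 < ρ₁) (hρ₂ : 0 < ρ₂) (hy : 0 ≤ y) (hx : 0 ≤ x)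
    (hxx : x ≤ x') : zfSinr ρ₁ ρ₂ x y ≤ zfSinr ρ₁ ρ₂ x' y := by
  have hx' := hx.trans hxx
  rw [zfSinr, zfSinr, div_le_div_iff₀ (by positivity) (by positivity)]
  have : 0 ≤ ρ₁ * ρ₂ * y * (ρ₂ * y + 1) * (x' - x) :=
    mul_nonneg (by positivity) (sub_nonneg.2 hxx)
  nlinarith

/-- The SINR stays below its limit `ρ₂ y` as `x` grows, so it reaches `γ` only if `ρ₂ y > γ`, and
then exactly when `x` exceeds a threshold. -/
theorem le_zfSinr_iff {ρ₁ ρ₂ x y γ : ℝ} (hρ₁ : 0 < ρ₁) (hρ₂ : 0 < ρ₂) (hγ : 0 < γ) (hy : 0 ≤ y)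
    (hx : 0 ≤ x) : γ ≤ zfSinr ρ₁ ρ₂ x y ↔
      γ / ρ₂ < y ∧ γ * (ρ₂ * y + 1) / (ρ₁ * (ρ₂ * y - γ)) ≤ x := by
  rw [zfSinr, le_div_iff₀ (by positivity), div_lt_iff₀ hρ₂]
  constructor
  · intro h
    have h0 : γ < y * ρ₂ := by
      by_contra hle
      push Not at hle
      have h1 : 0 ≤ (γ - y * ρ₂) * (ρ₁ * x) :=
        mul_nonneg (sub_nonneg.2 hle) (by positivity)
      have h2 : 0 ≤ γ * (ρ₂ * y) := by positivity
      nlinarith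
    refine ⟨h0, ?_⟩
    rw [div_le_iff₀ (mul_pos hρ₁ (by linarith))]
    linarith
  · rintro ⟨h0, h⟩
    rw [div_le_iff₀ (mul_pos hρ₁ (by linarith))] at h
    linarith

theorem mrtPrecoder_mulVec (h₂ : Fin N → ℂ) (a : ℝ) (w v : Fin N → ℂ) :
    mrtPrecoder h₂ a w *ᵥ v = (((a / Real.sqrt (normSq h₂) : ℝ) : ℂ) * (w ⬝ᵥ v)) • star h₂ := by
  rw [mrtPrecoder, smul_mulVec, vecMulVec_mulVec, mul_smul]
  congr 1
  ext i
  simp [mul_comm]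

theorem norm_sq_div_sqrt_normSq (h₂ : Fin N → ℂ) (a : ℝ) :
    ‖((a / Real.sqrt (normSq h₂) : ℝ) : ℂ)‖ ^ 2 = a ^ 2 / normSq h₂ := by
  rw [Complex.norm_real, Real.norm_eq_abs, sq_abs, div_pow, Real.sq_sqrt (normSq_nonneg _)]

/-- The normalization by `‖h₂‖` makes the Frobenius norm of the precoder independent of `h₂`. -/
theorem frobSq_mrtPrecoder {h₂ : Fin N → ℂ} (hy : 0 < normSq h₂) (a : ℝ) (w : Fin N → ℂ) :
    frobSq (mrtPrecoder h₂ a w) = a ^ 2 * normSq w := by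
  have h : ∀ i j, ‖mrtPrecoder h₂ a w i j‖ ^ 2 = a ^ 2 / normSq h₂ * ‖h₂ i‖ ^ 2 * ‖w j‖ ^ 2 := by
    intro i j
    rw [mrtPrecoder, Matrix.smul_apply, vecMulVec_apply, smul_eq_mul, norm_mul, mul_pow,
      norm_sq_div_sqrt_normSq, norm_mul, mul_pow, Pi.star_apply, norm_star]
    ring
  simp only [frobSq, h, ← Finset.mul_sum, ← Finset.sum_mul]
  change a ^ 2 / normSq h₂ * normSq h₂ * normSq w = _
  field_simp

theorem vecMul_mrtPrecoder (h₂ : Fin N → ℂ) (a : ℝ) (w : Fin N → ℂ) :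
    h₂ ᵥ* mrtPrecoder h₂ a w =
      (((a / Real.sqrt (normSq h₂) : ℝ) : ℂ) * (normSq h₂ : ℂ)) • w := by
  rw [mrtPrecoder, vecMul_smul, vecMul_vecMulVec, mul_smul, ofReal_normSq, dotProduct_comm]

theorem relayPower_mrtPrecoder (p : Powers M) (h₁ : Fin N → ℂ) {h₂ : Fin N → ℂ}
    (hy : 0 < normSq h₂) {H : Matrix (Fin N) (Fin M) ℂ} (a : ℝ) {w : Fin N → ℂ}
    (hw : normSq w = 1) (hwH : w ᵥ* H = 0) :
    relayPower p h₁ H (mrtPrecoder h₂ a w) = a ^ 2 * (‖w ⬝ᵥ h₁‖ ^ 2 * p.Ps + p.N0) := by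
  have hcol : ∀ i, w ⬝ᵥ H.col i = 0 := fun i => congrFun hwH i
  simp only [relayPower, mrtPrecoder_mulVec, hcol, mul_zero, zero_smul, normSq_smul, norm_mul,
    mul_pow, norm_sq_div_sqrt_normSq, normSq_star, frobSq_mrtPrecoder hy, hw]
  have h0 : normSq (0 : Fin N → ℂ) = 0 := normSq_eq_zero.2 rfl
  simp only [h0, zero_mul, Finset.sum_const_zero, add_zero]
  field_simp

theorem sinr_mrtPrecoder (p : Powers M) (h₁ : Fin N → ℂ) {h₂ : Fin N → ℂ}
    (hy : 0 < normSq h₂) {H : Matrix (Fin N) (Fin M) ℂ} (a : ℝ) {w : Fin N → ℂ}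
    (hw : normSq w = 1) (hwH : w ᵥ* H = 0) :
    sinr p h₁ h₂ H (mrtPrecoder h₂ a w) =
      a ^ 2 * normSq h₂ * ‖w ⬝ᵥ h₁‖ ^ 2 * p.Ps / (a ^ 2 * normSq h₂ * p.N0 + p.N0) := by
  have hcol : ∀ i, w ⬝ᵥ H.col i = 0 := fun i => congrFun hwH i
  have hn : ‖((normSq h₂ : ℝ) : ℂ)‖ ^ 2 = normSq h₂ ^ 2 := by
    rw [Complex.norm_real, Real.norm_eq_abs, sq_abs]
  have hs : h₂ ⬝ᵥ star h₂ = ((normSq h₂ : ℝ) : ℂ) := by rw [ofReal_normSq, dotProduct_comm]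
  have hne := hy.ne'
  have e : a ^ 2 / normSq h₂ * normSq h₂ ^ 2 = a ^ 2 * normSq h₂ := by field_simp
  simp only [sinr, mrtPrecoder_mulVec, hcol, mul_zero, zero_smul, dotProduct_zero, norm_zero,
    dotProduct_smul, smul_eq_mul, norm_mul, mul_pow, norm_sq_div_sqrt_normSq, hs, hn,
    vecMul_mrtPrecoder, normSq_smul, hw, ne_eq, OfNat.ofNat_ne_zero, not_false_eq_true, zero_pow,
    zero_mul, Finset.sum_const_zero, zero_add, mul_one, e]
  congr 1
  linear_combination ‖w ⬝ᵥ h₁‖ ^ 2 * p.Ps * e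

/-- Under the relay power constraint the SINR of a zero-forcing precoder depends on the combining
vector only through `‖w h₁‖²`. -/
theorem sinr_eq_zfSinr (p : Powers M) (h₁ : Fin N → ℂ) {h₂ : Fin N → ℂ}
    (hy : 0 < normSq h₂) {H : Matrix (Fin N) (Fin M) ℂ} {a : ℝ} {w : Fin N → ℂ}
    (hw : normSq w = 1) (hwH : w ᵥ* H = 0)
    (hpow : relayPower p h₁ H (mrtPrecoder h₂ a w) = p.Pr) :
    sinr p h₁ h₂ H (mrtPrecoder h₂ a w) =
      zfSinr (p.Ps / p.N0) (p.Pr / p.N0) (‖w ⬝ᵥ h₁‖ ^ 2) (normSq h₂) := by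
  rw [relayPower_mrtPrecoder p h₁ hy a hw hwH] at hpow
  rw [sinr_mrtPrecoder p h₁ hy a hw hwH, zfSinr]
  have hN := p.N0_pos
  have hPs := p.Ps_pos
  have hPr := p.Pr_pos
  have hx : 0 ≤ ‖w ⬝ᵥ h₁‖ ^ 2 := by positivity
  rw [div_eq_div_iff (by positivity) (by positivity), ← hpow]
  field_simp
  ring

theorem norm_dotProduct_sq_le (u v : Fin N → ℂ) : ‖u ⬝ᵥ v‖ ^ 2 ≤ normSq u * normSq v := by
  have h1 : ‖u ⬝ᵥ v‖ ≤ ∑ i, ‖u i‖ * ‖v i‖ :=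
    (norm_sum_le _ _).trans (le_of_eq (by simp))
  exact (pow_le_pow_left₀ (norm_nonneg _) h1 2).trans (Finset.sum_mul_sq_le_sq_mul_sq _ _ _)

theorem norm_dotProduct_sq_le_zfProjection {H : Matrix (Fin N) (Fin M) ℂ} {w : Fin N → ℂ}
    (hw : normSq w = 1) (hwH : w ᵥ* H = 0) (h₁ : Fin N → ℂ) :
    ‖w ⬝ᵥ h₁‖ ^ 2 ≤ normSq (zfProjection H *ᵥ h₁) := by
  conv_lhs => rw [← vecMul_zfProjection hwH, ← dotProduct_mulVec]
  simpa [hw] using norm_dotProduct_sq_le w (zfProjection H *ᵥ h₁)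

theorem exists_unit_vecMul_eq_zero (hNM : M < N) (H : Matrix (Fin N) (Fin M) ℂ) :
    ∃ w : Fin N → ℂ, normSq w = 1 ∧ w ᵥ* H = 0 := by
  have h : LinearMap.ker (vecMulLinear H) ≠ ⊥ :=
    LinearMap.ker_ne_bot_of_finrank_lt (by simpa using hNM)
  obtain ⟨v, hv, hv0⟩ := (Submodule.ne_bot_iff _).1 h
  have hpos : 0 < normSq v := (normSq_nonneg v).lt_of_ne' fun h => hv0 (normSq_eq_zero.1 h)
  have hvH : v ᵥ* H = 0 := hv
  refine ⟨(((Real.sqrt (normSq v))⁻¹ : ℝ) : ℂ) • v, ?_, ?_⟩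
  · rw [normSq_smul, Complex.norm_real, Real.norm_eq_abs, sq_abs, inv_pow,
      Real.sq_sqrt hpos.le, inv_mul_cancel₀ hpos.ne']
  · rw [smul_vecMul, hvH, smul_zero]

/-- The Cauchy-Schwarz bound `norm_dotProduct_sq_le_zfProjection` is attained by the normalized
projection of `h₁`, and by any zero-forcing unit vector if that projection vanishes. -/
theorem exists_norm_dotProduct_sq_eq (hNM : M < N) {H : Matrix (Fin N) (Fin M) ℂ}
    (hH : IsUnit (Hᴴ * H).det) (h₁ : Fin N → ℂ) :
    ∃ w : Fin N → ℂ, normSq w = 1 ∧ w ᵥ* H = 0 ∧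
      ‖w ⬝ᵥ h₁‖ ^ 2 = normSq (zfProjection H *ᵥ h₁) := by
  set u := zfProjection H *ᵥ h₁ with hu
  rcases (normSq_nonneg u).eq_or_lt with h0 | hpos
  · obtain ⟨w, hw, hwH⟩ := exists_unit_vecMul_eq_zero hNM H
    refine ⟨w, hw, hwH, le_antisymm (norm_dotProduct_sq_le_zfProjection hw hwH h₁) ?_⟩
    rw [← h0]
    positivity
  · have hc : ‖(((Real.sqrt (normSq u))⁻¹ : ℝ) : ℂ)‖ ^ 2 = (normSq u)⁻¹ := by
      rw [Complex.norm_real, Real.norm_eq_abs, sq_abs, inv_pow, Real.sq_sqrt hpos.le]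
    have hsu : star u = star h₁ ᵥ* zfProjection H := by
      rw [hu, star_mulVec, (isHermitian_zfProjection H).eq]
    refine ⟨(((Real.sqrt (normSq u))⁻¹ : ℝ) : ℂ) • star u, ?_, ?_, ?_⟩
    · rw [normSq_smul, hc, normSq_star, inv_mul_cancel₀ hpos.ne']
    · rw [smul_vecMul, hsu, vecMul_vecMul, zfProjection_mul_self_left hH, vecMul_zero, smul_zero]
    · have hp : star u ᵥ* zfProjection H = star u := by
        rw [hsu, vecMul_vecMul, zfProjection_mul_self hH]
      have hd : star u ⬝ᵥ h₁ = ((normSq u : ℝ) : ℂ) := by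
        rw [ofReal_normSq]
        conv_lhs => rw [← hp, ← dotProduct_mulVec]
      rw [smul_dotProduct, hd, smul_eq_mul, norm_mul, mul_pow, hc, Complex.norm_real,
        Real.norm_eq_abs, sq_abs]
      field_simp

/-- The optimal zero-forcing SINR is attained. -/
theorem exists_isZFAdmissible (hNM : M < N) (p : Powers M) (h₁ : Fin N → ℂ) {h₂ : Fin N → ℂ}
    (hy : 0 < normSq h₂) {H : Matrix (Fin N) (Fin M) ℂ} (hH : IsUnit (Hᴴ * H).det) :
    ∃ W, IsZFAdmissible p h₁ h₂ H W ∧ sinr p h₁ h₂ H W =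
      zfSinr (p.Ps / p.N0) (p.Pr / p.N0) (normSq (zfProjection H *ᵥ h₁)) (normSq h₂) := by
  obtain ⟨w, hw, hwH, hx⟩ := exists_norm_dotProduct_sq_eq hNM hH h₁
  have hN := p.N0_pos
  have hPs := p.Ps_pos
  have hPr := p.Pr_pos
  -- the amplification that exhausts the relay power
  set a := Real.sqrt (p.Pr / (‖w ⬝ᵥ h₁‖ ^ 2 * p.Ps + p.N0))
  have hpow : relayPower p h₁ H (mrtPrecoder h₂ a w) = p.Pr := by
    rw [relayPower_mrtPrecoder p h₁ hy a hw hwH, Real.sq_sqrt (by positivity)]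
    field_simp
  refine ⟨mrtPrecoder h₂ a w, ⟨⟨a, w, hw, hwH, rfl⟩, hpow⟩, ?_⟩
  rw [sinr_eq_zfSinr p h₁ hy hw hwH hpow, hx]

theorem IsZFAdmissible.sinr_le {p : Powers M} {h₁ h₂ : Fin N → ℂ}
    (hy : 0 < normSq h₂) {H : Matrix (Fin N) (Fin M) ℂ} {W : Matrix (Fin N) (Fin N) ℂ}
    (hW : IsZFAdmissible p h₁ h₂ H W) : sinr p h₁ h₂ H W ≤
      zfSinr (p.Ps / p.N0) (p.Pr / p.N0) (normSq (zfProjection H *ᵥ h₁)) (normSq h₂) := by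
  obtain ⟨⟨a, w, hw, hwH, rfl⟩, hpow⟩ := hW
  rw [sinr_eq_zfSinr p h₁ hy hw hwH hpow]
  exact zfSinr_mono (div_pos p.Ps_pos p.N0_pos) (div_pos p.Pr_pos p.N0_pos) hy.le (by positivity)
    (norm_dotProduct_sq_le_zfProjection hw hwH h₁)

theorem exists_isZFMRT (hNM : M < N) (p : Powers M) (h₁ : Fin N → ℂ) {h₂ : Fin N → ℂ}
    (hy : 0 < normSq h₂) {H : Matrix (Fin N) (Fin M) ℂ} (hH : IsUnit (Hᴴ * H).det) :
    ∃ W, IsZFMRT p h₁ h₂ H W := by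
  obtain ⟨W, hW, hs⟩ := exists_isZFAdmissible hNM p h₁ hy hH
  exact ⟨W, hW, fun W' hW' => hs ▸ hW'.sinr_le hy⟩

theorem IsZFMRT.sinr_eq (hNM : M < N) {p : Powers M} {h₁ h₂ : Fin N → ℂ}
    (hy : 0 < normSq h₂) {H : Matrix (Fin N) (Fin M) ℂ} (hH : IsUnit (Hᴴ * H).det)
    {W : Matrix (Fin N) (Fin N) ℂ} (hW : IsZFMRT p h₁ h₂ H W) : sinr p h₁ h₂ H W =
      zfSinr (p.Ps / p.N0) (p.Pr / p.N0) (normSq (zfProjection H *ᵥ h₁)) (normSq h₂) := by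
  obtain ⟨W', hW', hs⟩ := exists_isZFAdmissible hNM p h₁ hy hH
  exact le_antisymm (hW.1.sinr_le hy) (hs ▸ hW.2 W' hW')

/-! ### Almost sure linear independence -/

/-- The rank one projection onto `star w` has an exponential squared norm, which has no atom at
`0`. -/
theorem gaussianVector_dotProduct_eq_zero {w : Fin N → ℂ} (hw : w ≠ 0) :
    gaussianVector N {v | w ⬝ᵥ v = 0} = 0 := by
  have hpos : 0 < normSq w := (normSq_nonneg w).lt_of_ne' fun h => hw (normSq_eq_zero.1 h)
  have hc : ((normSq w : ℝ) : ℂ) ≠ 0 := by exact_mod_cast hpos.ne'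
  set P : Matrix (Fin N) (Fin N) ℂ := ((normSq w : ℝ) : ℂ)⁻¹ • vecMulVec (star w) w with hP
  have hww : w ⬝ᵥ star w = ((normSq w : ℝ) : ℂ) := by rw [ofReal_normSq, dotProduct_comm]
  have h1 : P.IsHermitian := by
    rw [IsHermitian, hP, conjTranspose_smul, conjTranspose_vecMulVec, star_star, star_inv₀]
    simp
  have h2 : P * P = P := by
    rw [hP, Matrix.smul_mul, Matrix.mul_smul, vecMulVec_mul_vecMulVec, hww, vecMulVec_smul,
      smul_smul, smul_smul, mul_assoc, inv_mul_cancel₀ hc, mul_one]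
  have h3 : P.trace = (1 : ℕ) := by
    rw [hP, trace_smul, trace_vecMulVec, dotProduct_comm, hww, smul_eq_mul, inv_mul_cancel₀ hc,
      Nat.cast_one]
  have hlaw := hasLaw_normSq_projection one_pos h1 h2 h3
  have h0 : gaussianVector N {v | normSq (P *ᵥ v) = 0} = 0 := by
    rw [hlaw.measure_eq (p := fun x => x = 0) (measurableSet_singleton 0), gammaMeasure]
    exact withDensity_absolutelyContinuous _ _ (by simp)
  refine measure_mono_null (fun v hv => ?_) h0
  have hv : w ⬝ᵥ v = 0 := hv
  change normSq (P *ᵥ v) = 0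
  rw [normSq_eq_zero, hP, smul_mulVec, vecMulVec_mulVec, hv]
  simp

theorem gaussianVector_submodule {S : Submodule ℂ (Fin N → ℂ)} (hS : S ≠ ⊤) :
    gaussianVector N S = 0 := by
  obtain ⟨f, hf, hSf⟩ := S.exists_le_ker_of_lt_top (lt_top_iff_ne_top.2 hS)
  set w : Fin N → ℂ := fun i => f (Pi.single i 1) with hw
  have hfw : ∀ v, f v = w ⬝ᵥ v := fun v => by
    have := LinearMap.pi_apply_eq_sum_univ f v
    rw [this]
    refine Finset.sum_congr rfl fun i _ => ?_
    rw [smul_eq_mul, mul_comm, hw]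
    congr 2
    ext j
    simp [Pi.single_apply, eq_comm]
  have hw0 : w ≠ 0 := fun h => hf (LinearMap.ext fun v => by rw [hfw, h]; simp)
  refine measure_mono_null (fun v hv => ?_) (gaussianVector_dotProduct_eq_zero hw0)
  change w ⬝ᵥ v = 0
  rw [← hfw]
  exact hSf hv

/-- By induction: given linearly independent columns, an independent further one avoids their span,
a proper subspace, almost surely. -/
theorem ae_linearIndependent_gaussianVector (hMN : M ≤ N) :
    ∀ᵐ A ∂(Measure.pi fun _ : Fin M => gaussianVector N), LinearIndependent ℂ A := by
  induction M with
  | zero => exact ae_of_all _ fun A => linearIndependent_empty_type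
  | succ M ih =>
    have hmp := measurePreserving_piFinSuccAbove (fun _ : Fin (M + 1) => gaussianVector N) 0
    have hmeas' : MeasurableSet {q : (Fin N → ℂ) × (Fin M → Fin N → ℂ) |
        LinearIndependent ℂ (Fin.cons q.1 q.2 : Fin (M + 1) → Fin N → ℂ)} := by
      refine IsOpen.measurableSet ?_
      exact isOpen_setOfPred_linearIndependent.preimage
        (f := fun q : (Fin N → ℂ) × (Fin M → Fin N → ℂ) =>
          (Fin.cons q.1 q.2 : Fin (M + 1) → Fin N → ℂ))
        (continuous_pi fun i => by refine Fin.cases ?_ (fun j => ?_) i <;> simp <;> fun_prop)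
    have key : ∀ᵐ q ∂((gaussianVector N).prod (Measure.pi fun _ : Fin M => gaussianVector N)),
        LinearIndependent ℂ (Fin.cons q.1 q.2 : Fin (M + 1) → Fin N → ℂ) := by
      rw [ae_iff]
      change ((gaussianVector N).prod (Measure.pi fun _ : Fin M => gaussianVector N))
        ({q : (Fin N → ℂ) × (Fin M → Fin N → ℂ) |
        LinearIndependent ℂ (Fin.cons q.1 q.2 : Fin (M + 1) → Fin N → ℂ)}ᶜ) = 0
      rw [Measure.prod_apply_symm hmeas'.compl, lintegral_eq_zero_iff
        (measurable_measure_prodMk_right hmeas'.compl)]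
      filter_upwards [ih (by omega)] with A hA
      have hS : Submodule.span ℂ (range A) ≠ ⊤ := by
        intro h
        have h1 := finrank_range_le_card (R := ℂ) A
        rw [Set.finrank, h, finrank_top, Module.finrank_fin_fun, Fintype.card_fin] at h1
        omega
      refine measure_mono_null (fun v hv => ?_) (gaussianVector_submodule hS)
      by_contra hvS
      exact hv (linearIndependent_finCons.2 ⟨hA, hvS⟩)
    have := hmp.quasiMeasurePreserving.ae key
    filter_upwards [this] with A hA
    convert hA using 1
    ext i
    refine Fin.cases ?_ (fun j => ?_) i <;> simp [MeasurableEquiv.piFinSuccAbove_apply, Fin.tail]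

/-! ### Measurability and the joint law of the channels -/

theorem measurable_det_of_entries {α ι : Type*} [MeasurableSpace α] [Fintype ι] [DecidableEq ι]
    {A : α → Matrix ι ι ℂ} (hA : ∀ i j, Measurable fun x => A x i j) :
    Measurable fun x => (A x).det := by
  simp only [det_apply]
  fun_prop

theorem measurable_inv_of_entries {α ι : Type*} [MeasurableSpace α] [Fintype ι] [DecidableEq ι]
    {A : α → Matrix ι ι ℂ} (hA : ∀ i j, Measurable fun x => A x i j) (i j : ι) :
    Measurable fun x => (A x)⁻¹ i j := by
  simp only [inv_def, Matrix.smul_apply, Ring.inverse_eq_inv', adjugate_apply, smul_eq_mul]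
  refine (measurable_det_of_entries hA).inv.mul (measurable_det_of_entries fun k l => ?_)
  by_cases h : k = j
  · subst h; simp only [updateRow_self]; exact measurable_const
  · simp only [updateRow_ne h]; exact hA k l

theorem measurable_normSq_zfProjection :
    Measurable fun q : (Fin N → ℂ) × (Fin M → Fin N → ℂ) =>
      normSq (zfProjection (Matrix.of q.2)ᵀ *ᵥ q.1) := by
  have hG : ∀ i j, Measurable fun q : (Fin N → ℂ) × (Fin M → Fin N → ℂ) =>
      ((Matrix.of q.2)ᵀᴴ * (Matrix.of q.2)ᵀ) i j := fun i j => by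
    simp only [Matrix.mul_apply, conjTranspose_apply, transpose_apply, Matrix.of_apply]
    exact Finset.measurable_sum _ fun k _ => Measurable.mul (by fun_prop) (by fun_prop)
  have hGi := measurable_inv_of_entries hG
  have hP : ∀ i j, Measurable fun q : (Fin N → ℂ) × (Fin M → Fin N → ℂ) =>
      zfProjection (Matrix.of q.2)ᵀ i j := fun i j => by
    simp only [zfProjection, Matrix.sub_apply, Matrix.mul_apply (N := (Matrix.of _)ᵀᴴ),
      Matrix.mul_apply (M := (Matrix.of _)ᵀ), conjTranspose_apply, transpose_apply,
      Matrix.of_apply]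
    exact (Finset.measurable_sum _ fun k _ => Measurable.mul (Finset.measurable_sum _ fun l _ =>
      Measurable.mul (by fun_prop) (hGi l k)) (by fun_prop)).const_sub _
  simp only [normSq, mulVec, dotProduct]
  fun_prop

theorem measurableSet_le_zfSinr (ρ₁ ρ₂ γ : ℝ) :
    MeasurableSet {q : (Fin N → ℂ) × (Fin N → ℂ) × (Fin M → Fin N → ℂ) |
      γ ≤ zfSinr ρ₁ ρ₂ (normSq (zfProjection (Matrix.of q.2.2)ᵀ *ᵥ q.1)) (normSq q.2.1)} := by
  have hz : Measurable fun r : ℝ × ℝ => zfSinr ρ₁ ρ₂ r.1 r.2 := by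
    unfold zfSinr; fun_prop
  have hx : Measurable fun q : (Fin N → ℂ) × (Fin N → ℂ) × (Fin M → Fin N → ℂ) =>
      normSq (zfProjection (Matrix.of q.2.2)ᵀ *ᵥ q.1) := by
    have hg : Measurable fun q : (Fin N → ℂ) × (Fin N → ℂ) × (Fin M → Fin N → ℂ) =>
        (q.1, q.2.2) := by fun_prop
    have := (measurable_normSq_zfProjection (N := N) (M := M)).comp hg
    exact this
  have hy : Measurable fun q : (Fin N → ℂ) × (Fin N → ℂ) × (Fin M → Fin N → ℂ) =>
      normSq q.2.1 := by fun_prop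
  have hxy : Measurable fun q : (Fin N → ℂ) × (Fin N → ℂ) × (Fin M → Fin N → ℂ) =>
      zfSinr ρ₁ ρ₂ (normSq (zfProjection (Matrix.of q.2.2)ᵀ *ᵥ q.1)) (normSq q.2.1) := by
    have := hz.comp (hx.prodMk hy)
    exact this
  exact measurableSet_le measurable_const hxy

/-- The joint law of the channels: `h₁`, `h₂` and the columns of the interference matrix are
independent Gaussian vectors. -/
theorem IsRayleigh.hasLaw {Ω : Type*} [MeasurableSpace Ω] {μ : Measure Ω}
    {h₁ h₂ : Ω → Fin N → ℂ} {H : Ω → Matrix (Fin N) (Fin M) ℂ} (h : IsRayleigh μ h₁ h₂ H) :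
    HasLaw (fun ω => (h₁ ω, h₂ ω, fun i n => H ω n i))
      ((gaussianVector N).prod
        ((gaussianVector N).prod (Measure.pi fun _ : Fin M => gaussianVector N))) μ := by
  set X : Fin N ⊕ Fin N ⊕ Fin M × Fin N → Ω → ℂ :=
    Sum.elim (fun n ω => h₁ ω n) (Sum.elim (fun n ω => h₂ ω n) (fun q ω => H ω q.2 q.1)) with hX
  have hind : iIndepFun X μ := by
    have := h.indep.precomp (g := Sum.map id (Sum.map id (Prod.swap : Fin M × Fin N → _)))
      (Sum.map_injective.2 ⟨Function.injective_id,
        Sum.map_injective.2 ⟨Function.injective_id, Prod.swap_injective⟩⟩)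
    convert this using 1
    ext i ω
    rcases i with i | i | i <;> rfl
  have hlaw : ∀ i, HasLaw (X i) stdComplexGaussian μ := by
    rintro (i | i | i)
    · exact h.law_h₁ i
    · exact h.law_h₂ i
    · exact h.law_H i.2 i.1
  have h1 := hind.hasLaw_pi hlaw
  have hcurry : MeasurePreserving (MeasurableEquiv.curry (Fin M) (Fin N) ℂ)
      (Measure.pi fun _ : Fin M × Fin N => stdComplexGaussian)
      (Measure.pi fun _ : Fin M => gaussianVector N) := by
    refine ⟨MeasurableEquiv.measurable _, ?_⟩
    have := Measure.infinitePi_map_curry fun (_ : Fin M) (_ : Fin N) => stdComplexGaussian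
    simpa only [Measure.infinitePi_eq_pi, gaussianVector] using this
  have m1 := measurePreserving_sumPiEquivProdPi
    (fun _ : Fin N ⊕ Fin N ⊕ Fin M × Fin N => stdComplexGaussian)
  have m2 := measurePreserving_sumPiEquivProdPi
    (fun _ : Fin N ⊕ Fin M × Fin N => stdComplexGaussian)
  have m3 := (MeasurePreserving.id (gaussianVector N)).prod
    (((MeasurePreserving.id (gaussianVector N)).prod hcurry).comp m2)
  exact (m3.comp m1).fun_comp_hasLaw h1

/-! ### The outage probability -/

/-- The probability of no outage, conditioning on `h₂` and on the interference matrix. -/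
theorem measure_zfSinr_ge (hNM : M < N) {ρ₁ ρ₂ γ : ℝ} (hρ₁ : 0 < ρ₁) (hρ₂ : 0 < ρ₂) (hγ : 0 < γ) :
    ((gaussianVector N).prod
        ((gaussianVector N).prod (Measure.pi fun _ : Fin M => gaussianVector N)))
      {q | γ ≤ zfSinr ρ₁ ρ₂ (normSq (zfProjection (Matrix.of q.2.2)ᵀ *ᵥ q.1)) (normSq q.2.1)} =
    ∫⁻ y in Ioi (γ / ρ₂), ENNReal.ofReal
        (Real.exp (-(γ * (ρ₂ * y + 1) / (ρ₁ * (ρ₂ * y - γ)))) *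
          ∑ m ∈ Finset.range (N - M),
            (γ * (ρ₂ * y + 1) / (ρ₁ * (ρ₂ * y - γ))) ^ m / m.factorial)
        ∂(gammaMeasure N 1) := by
  have hN : 0 < N := by omega
  set F : ℝ → ENNReal := (Ioi (γ / ρ₂)).indicator fun y => ENNReal.ofReal
        (Real.exp (-(γ * (ρ₂ * y + 1) / (ρ₁ * (ρ₂ * y - γ)))) *
          ∑ m ∈ Finset.range (N - M),
            (γ * (ρ₂ * y + 1) / (ρ₁ * (ρ₂ * y - γ))) ^ m / m.factorial) with hF
  have hFm : Measurable F := Measurable.indicator (by fun_prop) measurableSet_Ioi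
  have hLI : ∀ᵐ r ∂((gaussianVector N).prod (Measure.pi fun _ : Fin M => gaussianVector N)),
      LinearIndependent ℂ r.2 :=
    Measure.quasiMeasurePreserving_snd.ae (ae_linearIndependent_gaussianVector hNM.le)
  rw [Measure.prod_apply_symm (measurableSet_le_zfSinr ρ₁ ρ₂ γ),
    ← lintegral_indicator measurableSet_Ioi, ← hF,
    ← (hasLaw_normSq_gaussianVector hN).lintegral_comp hFm.aemeasurable]
  have hfst : ∫⁻ b, F (normSq b) ∂(gaussianVector N) = ∫⁻ r, F (normSq r.1)
      ∂((gaussianVector N).prod (Measure.pi fun _ : Fin M => gaussianVector N)) :=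
    (measurePreserving_fst.lintegral_comp (hFm.comp measurable_normSq)).symm
  rw [hfst]
  refine lintegral_congr_ae ?_
  filter_upwards [hLI] with ⟨b, A⟩ hA
  have hdet := isUnit_det_conjTranspose_mul_self (H := (Matrix.of A)ᵀ) hA
  have htr := trace_zfProjection hdet
  rw [← Nat.cast_sub hNM.le] at htr
  have hlaw := hasLaw_normSq_projection (by omega) (isHermitian_zfProjection _)
    (zfProjection_mul_self hdet) htr
  have hset : (fun a : Fin N → ℂ => (a, b, A)) ⁻¹'
      {q : (Fin N → ℂ) × (Fin N → ℂ) × (Fin M → Fin N → ℂ) |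
        γ ≤ zfSinr ρ₁ ρ₂ (normSq (zfProjection (Matrix.of q.2.2)ᵀ *ᵥ q.1)) (normSq q.2.1)} =
      {a | γ / ρ₂ < normSq b ∧ γ * (ρ₂ * normSq b + 1) / (ρ₁ * (ρ₂ * normSq b - γ)) ≤
        normSq (zfProjection (Matrix.of A)ᵀ *ᵥ a)} := by
    ext a
    exact le_zfSinr_iff hρ₁ hρ₂ hγ (normSq_nonneg _) (normSq_nonneg _)
  rw [hset]
  by_cases hb : γ / ρ₂ < normSq b
  · have hb' : γ < ρ₂ * normSq b := by rwa [div_lt_iff₀' hρ₂] at hb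
    have ht : 0 ≤ γ * (ρ₂ * normSq b + 1) / (ρ₁ * (ρ₂ * normSq b - γ)) :=
      div_nonneg (by nlinarith) (mul_nonneg hρ₁.le (by linarith))
    obtain ⟨k, hk⟩ : ∃ k, N - M = k + 1 := ⟨N - M - 1, by omega⟩
    simp only [hb, true_and, hF]
    rw [indicator_of_mem (show normSq b ∈ Ioi (γ / ρ₂) from hb),
      hlaw.measure_eq (p := fun x => γ * (ρ₂ * normSq b + 1) / (ρ₁ * (ρ₂ * normSq b - γ)) ≤ x)
        measurableSet_Ici, hk]
    push_cast
    exact gammaMeasure_Ici k _ ht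
  · simp only [hb, false_and, hF]
    rw [indicator_of_notMem (show normSq b ∉ Ioi (γ / ρ₂) from hb)]
    simp
end AFRelay

open AFRelay in
theorem theorem3 {N M : ℕ} (hNM : M < N)
    {Ω : Type*} [MeasurableSpace Ω] (μ : Measure Ω) [IsProbabilityMeasure μ]
    (h₁ h₂ : Ω → Fin N → ℂ) (H : Ω → Matrix (Fin N) (Fin M) ℂ)
    (hchan : AFRelay.IsRayleigh μ h₁ h₂ H)
    (p : AFRelay.Powers M) (ρ₁ ρ₂ γ : ℝ)
    (hρ₁ : ρ₁ = p.Ps / p.N0) (hρ₂ : ρ₂ = p.Pr / p.N0) (hγ : 0 < γ) :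
    (∀ᵐ ω ∂μ, ∃ W, AFRelay.IsZFMRT p (h₁ ω) (h₂ ω) (H ω) W) ∧
    ∀ W : Ω → Matrix (Fin N) (Fin N) ℂ,
      (∀ᵐ ω ∂μ, AFRelay.IsZFMRT p (h₁ ω) (h₂ ω) (H ω) (W ω)) →
      μ.real {ω | AFRelay.sinr p (h₁ ω) (h₂ ω) (H ω) (W ω) < γ} =
        1 - 2 * Real.exp (-(γ / ρ₁) - γ / ρ₂) / Real.Gamma N *
          ∑ m ∈ Finset.range (N - M), (γ / ρ₁) ^ m * (1 / (m.factorial : ℝ)) *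
            ∑ j ∈ Finset.range (m + 1), (m.choose j : ℝ) * (1 / ρ₂) ^ (m - j) *
              ∑ k ∈ Finset.range (N + j), ((N + j - 1).choose k : ℝ) *
                (γ / ρ₂) ^ (N + j - 1 - k) *
                ((1 + γ) * γ / (ρ₁ * ρ₂)) ^ (((k : ℝ) - m + 1) / 2) *
                AFRelay.besselK ((k : ℝ) - m + 1)
                  (2 * Real.sqrt ((1 + γ) * γ / (ρ₁ * ρ₂))) := by
  have hr₁ : 0 < ρ₁ := hρ₁ ▸ div_pos p.Ps_pos p.N0_pos
  have hr₂ : 0 < ρ₂ := hρ₂ ▸ div_pos p.Pr_pos p.N0_pos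
  have hN : 0 < N := by omega
  have : NeZero N := ⟨hN.ne'⟩
  have hlaw := hchan.hasLaw
  have hy : ∀ᵐ ω ∂μ, 0 < normSq (h₂ ω) := by
    have h0 : ∀ᵐ v ∂(gaussianVector N), v ≠ 0 := by
      refine measure_mono_null (fun v hv => ?_)
        (gaussianVector_submodule (S := ⊥) (N := N) bot_ne_top)
      simpa using hv
    have h1 : ∀ᵐ q ∂((gaussianVector N).prod
        ((gaussianVector N).prod (Measure.pi fun _ : Fin M => gaussianVector N))),
        q.2.1 ≠ 0 :=
      Measure.quasiMeasurePreserving_snd.ae (Measure.quasiMeasurePreserving_fst.ae h0)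
    rw [← hlaw.map_eq] at h1
    filter_upwards [ae_of_ae_map hlaw.aemeasurable h1] with ω hω
    exact (normSq_nonneg _).lt_of_ne' fun h => hω (normSq_eq_zero.1 h)
  have hH : ∀ᵐ ω ∂μ, IsUnit ((H ω)ᴴ * H ω).det := by
    have h1 : ∀ᵐ q ∂((gaussianVector N).prod
        ((gaussianVector N).prod (Measure.pi fun _ : Fin M => gaussianVector N))),
        LinearIndependent ℂ q.2.2 :=
      Measure.quasiMeasurePreserving_snd.ae (Measure.quasiMeasurePreserving_snd.ae
        (ae_linearIndependent_gaussianVector hNM.le))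
    rw [← hlaw.map_eq] at h1
    filter_upwards [ae_of_ae_map hlaw.aemeasurable h1] with ω hω
    exact isUnit_det_conjTranspose_mul_self hω
  refine ⟨?_, fun W hW => ?_⟩
  · filter_upwards [hy, hH] with ω h1 h2
    exact exists_isZFMRT hNM p (h₁ ω) h1 h2
  obtain ⟨r, hr0, hr, hint⟩ := lintegral_erlang_tail_gammaMeasure hN (N - M) hr₁ hr₂ hγ
  rw [← measure_zfSinr_ge hNM hr₁ hr₂ hγ] at hint
  rw [← hr]
  have hmeas := measurableSet_le_zfSinr (N := N) (M := M) ρ₁ ρ₂ γ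
  have hae : {ω | sinr p (h₁ ω) (h₂ ω) (H ω) (W ω) < γ} =ᵐ[μ]
      {ω | ¬ γ ≤ zfSinr ρ₁ ρ₂ (normSq (zfProjection (H ω) *ᵥ h₁ ω)) (normSq (h₂ ω))} := by
    filter_upwards [hy, hH, hW] with ω h1 h2 h3
    have := h3.sinr_eq hNM h1 h2
    rw [← hρ₁, ← hρ₂] at this
    refine propext ?_
    change sinr p (h₁ ω) (h₂ ω) (H ω) (W ω) < γ ↔ ¬ γ ≤ _
    rw [this, not_le]
  rw [measureReal_congr hae]
  have := hlaw.isProbabilityMeasure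
  refine (hlaw.measureReal_eq hmeas.compl).trans ?_
  change Measure.real _ (_ᶜ) = _
  rw [probReal_compl_eq_one_sub hmeas, measureReal_def, hint, ENNReal.toReal_ofReal hr0]
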